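/- Let $R$ be a commutative ring with identity; complexes of $R$-modules are indexed homologically by $\mathbb{Z}$. Definitions. A module is Gorenstein projective if it is isomorphic to $\operatorname{Coker}(X_1\to X_0)$ for an exact complex $X$ of projective modules such that $\operatorname{Hom}_R(X,P)$ is exact for every projective $P$; it is Gorenstein injective if it is isomorphic to $\operatorname{Ker}(Y_0\to Y_{-1})$ for an exact complex $Y$ of injective modules such that $\operatorname{Hom}_R(I,Y)$ is exact for every injective $I$. The Gorenstein projective dimension $\mathcal{GP}\text{-}\mathrm{pd}_R(M)$ is the infimum of the lengths $\sup\{n\ge 0 : X_n\ne 0\}$ of resolutions $X\to M$ by Gorenstein projective modules, and the Gorenstein injective dimension $\mathcal{GI}\text{-}\mathrm{id}_R(N)$ is defined dually. A Tate projective resolution of $M$ is a diagram of chain maps $T\xrightarrow{\alpha}W\to M$ in which $W\to M$ is a projective resolution, $T$ is an exact complex of projective modules with $\operatorname{Hom}_R(T,P)$ exact for every projective $P$, and $\alpha_n$ is an isomorphism for all $n\gg 0$. A Tate injective coresolution of $N$ is a diagram $N\to V\xrightarrow{\beta}S$ in which $N\to V$ is an injective coresolution, $S$ is an exact complex of injective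 modules with $\operatorname{Hom}_R(I,S)$ exact for every injective $I$, and $\beta_n$ is an isomorphism for all $n\ll 0$. For $n\in\mathbb{Z}$ set $$\widehat{\operatorname{Ext}}^n_{\mathcal P}(M,N)=H_{-n}(\operatorname{Hom}_R(T,N)),\qquad \widehat{\operatorname{Ext}}^n_{\mathcal I}(M,N)=H_{-n}(\operatorname{Hom}_R(M,S)).$$ Corollary 6.3. Let $M$ and $N$ be $R$-modules such that $\mathcal{GP}\text{-}\mathrm{pd}_R(M)<\infty$ and $\mathcal{GI}\text{-}\mathrm{id}_R(N)<\infty$. Then $M$ has a Tate projective resolution, $N$ has a Tate injective coresolution, and, whichever of these are used to compute the two Tate cohomologies, for each $n\ge 1$ there is an isomorphism of $R$-modules $$\widehat{\operatorname{Ext}}^n_{\mathcal P}(M,N)\cong\widehat{\operatorname{Ext}}^n_{\mathcal I}(M,N).$$ If $R$ is Gorenstein (that is, noetherian, with $R_{\mathfrak p}$ of finite injective dimension over itself for every prime $\mathfrak p$), then this isomorphism holds for all $n\in\mathbb{Z}$. -/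

import Mathlib

open CategoryTheory CategoryTheory.Limits Opposite

universe v u

noncomputable section

namespace RelTate

section Abelian

variable {C : Type u} [Category.{v} C] [Abelian C]

/-- An object regarded as a complex concentrated in degree `0`. Complexes are indexed
homologically by all integers, so the differentials are `X.d n (n - 1)`. -/
abbrev inDegreeZero (M : C) : ChainComplex C ℤ :=
  (HomologicalComplex.single C (ComplexShape.down ℤ) 0).obj M

/-- The complex of abelian groups `Hom(A, X)`, for an object `A` and a complex `X`. -/
abbrev homFrom (A : C) (X : ChainComplex C ℤ) :
    HomologicalComplex AddCommGrpCat.{v} (ComplexShape.down ℤ) :=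
  ((preadditiveCoyoneda.obj (op A)).mapHomologicalComplex (ComplexShape.down ℤ)).obj X

/-- The complex of abelian groups `Hom(X, A)`, for an object `A` and a complex `X`, with
`Hom(X_n, A)` placed in cohomological degree `n`. -/
abbrev homTo (X : ChainComplex C ℤ) (A : C) :
    HomologicalComplex AddCommGrpCat.{v} (ComplexShape.down ℤ).symm :=
  ((preadditiveYoneda.obj A).mapHomologicalComplex (ComplexShape.down ℤ).symm).obj X.op

/-- `X` is `Hom(𝒲, -)`-exact. -/
def IsHomFromExact (𝒲 : ObjectProperty C) (X : ChainComplex C ℤ) : Prop :=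
  ∀ A : C, 𝒲 A → (homFrom A X).Acyclic

/-- `X` is `Hom(-, 𝒲)`-exact. -/
def IsHomToExact (𝒲 : ObjectProperty C) (X : ChainComplex C ℤ) : Prop :=
  ∀ A : C, 𝒲 A → (homTo X A).Acyclic

/-- An `𝒳`-resolution of `M`: a complex `X` of objects of `𝒳`, zero in negative degrees, with a
quasi-isomorphism `X ⟶ M`. -/
structure Resolution (𝒳 : ObjectProperty C) (M : C) where
  X : ChainComplex C ℤ
  γ : X ⟶ inDegreeZero M
  mem : ∀ n : ℤ, 0 ≤ n → 𝒳 (X.X n)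
  isZero : ∀ n : ℤ, n < 0 → IsZero (X.X n)
  quasiIso : QuasiIso γ

/-- A `𝒴`-coresolution of `N`: a complex `Y` of objects of `𝒴`, zero in positive (homological)
degrees, with a quasi-isomorphism `N ⟶ Y`. -/
structure Coresolution (𝒴 : ObjectProperty C) (N : C) where
  Y : ChainComplex C ℤ
  δ : inDegreeZero N ⟶ Y
  mem : ∀ n : ℤ, n ≤ 0 → 𝒴 (Y.X n)
  isZero : ∀ n : ℤ, 0 < n → IsZero (Y.X n)
  quasiIso : QuasiIso δ

/-- The resolution is proper: its augmentation `⋯ ⟶ X₁ ⟶ X₀ ⟶ M ⟶ 0` is `Hom(𝒳, -)`-exact, i.e.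
`Hom(A, X) ⟶ Hom(A, M)` is a quasi-isomorphism for each `A` in `𝒳`. -/
def Resolution.IsProper {𝒳 : ObjectProperty C} {M : C} (ρ : Resolution 𝒳 M) : Prop :=
  ∀ A : C, 𝒳 A → QuasiIso
    (((preadditiveCoyoneda.obj (op A)).mapHomologicalComplex (ComplexShape.down ℤ)).map ρ.γ)

/-- The coresolution is proper: its augmentation `0 ⟶ N ⟶ Y₀ ⟶ Y₋₁ ⟶ ⋯` is `Hom(-, 𝒴)`-exact, i.e.
`Hom(Y, A) ⟶ Hom(N, A)` is a quasi-isomorphism for each `A` in `𝒴`. -/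
def Coresolution.IsProper {𝒴 : ObjectProperty C} {N : C} (ρ : Coresolution 𝒴 N) : Prop :=
  ∀ A : C, 𝒴 A → QuasiIso
    (((preadditiveYoneda.obj A).mapHomologicalComplex (ComplexShape.down ℤ).symm).map
      ((HomologicalComplex.opFunctor C (ComplexShape.down ℤ)).map ρ.δ.op))

/-- `sup {n ≥ 0 | X_n ≠ 0}`. -/
def Resolution.length {𝒳 : ObjectProperty C} {M : C} (ρ : Resolution 𝒳 M) : ℕ∞ :=
  ⨆ (n : ℕ) (_ : ¬ IsZero (ρ.X.X (n : ℤ))), (n : ℕ∞)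

/-- `sup {n ≥ 0 | Y_{-n} ≠ 0}`. -/
def Coresolution.length {𝒴 : ObjectProperty C} {N : C} (ρ : Coresolution 𝒴 N) : ℕ∞ :=
  ⨆ (n : ℕ) (_ : ¬ IsZero (ρ.Y.X (-(n : ℤ)))), (n : ℕ∞)

/-- The `𝒳`-projective dimension of `M`; it is `⊤` if `M` has no bounded `𝒳`-resolution. -/
def relProjDim (𝒳 : ObjectProperty C) (M : C) : ℕ∞ :=
  ⨅ ρ : Resolution 𝒳 M, ρ.length

/-- The `𝒴`-injective dimension of `N`; it is `⊤` if `N` has no bounded `𝒴`-coresolution. -/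
def relInjDim (𝒴 : ObjectProperty C) (N : C) : ℕ∞ :=
  ⨅ ρ : Coresolution 𝒴 N, ρ.length

/-- Totally `𝒲`-acyclic complexes: exact complexes of objects of `𝒲` that are both
`Hom(𝒲, -)`-exact and `Hom(-, 𝒲)`-exact. -/
structure IsTotallyAcyclic (𝒲 : ObjectProperty C) (T : ChainComplex C ℤ) : Prop where
  mem : ∀ n : ℤ, 𝒲 (T.X n)
  acyclic : T.Acyclic
  homFromExact : IsHomFromExact 𝒲 T
  homToExact : IsHomToExact 𝒲 T

/-- A Tate `𝒲`-resolution `T ⟶ W ⟶ M`. -/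
structure TateResolution (𝒲 : ObjectProperty C) (M : C) where
  T : ChainComplex C ℤ
  W : Resolution 𝒲 M
  α : T ⟶ W.X
  totallyAcyclic : IsTotallyAcyclic 𝒲 T
  isProper : W.IsProper
  isIso : ∃ n₀ : ℤ, ∀ n : ℤ, n₀ ≤ n → IsIso (α.f n)

/-- A Tate `𝒱`-coresolution `N ⟶ V ⟶ S`. -/
structure TateCoresolution (𝒱 : ObjectProperty C) (N : C) where
  S : ChainComplex C ℤ
  V : Coresolution 𝒱 N
  β : V.Y ⟶ S
  totallyAcyclic : IsTotallyAcyclic 𝒱 S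
  isProper : V.IsProper
  isIso : ∃ n₀ : ℤ, ∀ n : ℤ, n ≤ n₀ → IsIso (β.f n)

end Abelian

section Modules

variable {R : Type u} [CommRing R]

/-- Gorenstein projective modules: the modules `Coker (X₁ ⟶ X₀)` for `X` a complete projective
resolution, i.e. an exact and `Hom(-, projective)`-exact complex of projective modules. -/
def gorensteinProjective (R : Type u) [CommRing R] : ObjectProperty (ModuleCat.{u} R) := fun M =>
  ∃ X : ChainComplex (ModuleCat.{u} R) ℤ,
    (∀ n : ℤ, Projective (X.X n)) ∧ X.Acyclic ∧
    IsHomToExact (isProjective (ModuleCat.{u} R)) X ∧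
    Nonempty (M ≅ cokernel (X.d 1 0))

/-- Gorenstein injective modules: the modules `Ker (Y₀ ⟶ Y₋₁)` for `Y` a complete injective
resolution, i.e. an exact and `Hom(injective, -)`-exact complex of injective modules. -/
def gorensteinInjective (R : Type u) [CommRing R] : ObjectProperty (ModuleCat.{u} R) := fun N =>
  ∃ Y : ChainComplex (ModuleCat.{u} R) ℤ,
    (∀ n : ℤ, Injective (Y.X n)) ∧ Y.Acyclic ∧
    IsHomFromExact (isInjective (ModuleCat.{u} R)) Y ∧
    Nonempty (N ≅ kernel (Y.d 0 (-1)))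

/-- The Gorenstein projective dimension of a module. -/
def gorensteinProjDim (M : ModuleCat.{u} R) : ℕ∞ := relProjDim (gorensteinProjective R) M

/-- The Gorenstein injective dimension of a module. -/
def gorensteinInjDim (N : ModuleCat.{u} R) : ℕ∞ := relInjDim (gorensteinInjective R) N

/-- Tate resolutions by projective modules. -/
abbrev TateProjectiveResolution (M : ModuleCat.{u} R) :=
  TateResolution (isProjective (ModuleCat.{u} R)) M

/-- Tate coresolutions by injective modules. -/
abbrev TateInjectiveCoresolution (N : ModuleCat.{u} R) :=
  TateCoresolution (isInjective (ModuleCat.{u} R)) N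

/-- The Tate cohomology module `H_{-n}(Hom_R(T, N))` computed from a Tate projective resolution
`T ⟶ W ⟶ M`. The module `Hom_R(T_n, N)` sits in degree `n` of the complex below. -/
def TateResolution.tateExt {M : ModuleCat.{u} R} (τ : TateProjectiveResolution M)
    (N : ModuleCat.{u} R) (n : ℤ) : ModuleCat.{u} R :=
  ((((linearYoneda R (ModuleCat.{u} R)).obj N).mapHomologicalComplex
    (ComplexShape.down ℤ).symm).obj τ.T.op).homology n

/-- The Tate cohomology module `H_{-n}(Hom_R(M, S))` computed from a Tate injective coresolution
`N ⟶ V ⟶ S`. -/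
def TateCoresolution.tateExt {N : ModuleCat.{u} R} (σ : TateInjectiveCoresolution N)
    (M : ModuleCat.{u} R) (n : ℤ) : ModuleCat.{u} R :=
  ((((linearCoyoneda R (ModuleCat.{u} R)).obj (op M)).mapHomologicalComplex
    (ComplexShape.down ℤ)).obj σ.S).homology (-n)

/-- A commutative ring is Gorenstein if it is noetherian and each of its localizations at a prime
ideal has finite injective dimension as a module over itself. -/
structure IsGorensteinRing (R : Type u) [CommRing R] : Prop where
  isNoetherianRing : IsNoetherianRing R
  injectiveDimension_lt_top : ∀ (p : Ideal R) [p.IsPrime],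
    injectiveDimension (ModuleCat.of (Localization.AtPrime p) (Localization.AtPrime p)) < ⊤

end Modules

end RelTate

end

noncomputable section

namespace RelTate

/-! ### Short exact sequences of syzygies and cosyzygies in an exact complex. -/

section Syzygies

variable {C : Type u} [Category.{v} C] [Abelian C] (X : ChainComplex C ℤ)

/-! Comparison (`tateExt_iso`). Write `C_i` for the cokernel of `T_{i+1} ⟶ T_i` and `Z_i` for the
kernel of `S_i ⟶ S_{i-1}`. Both `H^0 Hom(T, Z_m)` and `H_m Hom(C_0, S)` are quotients of `Hom(C_0,
Z_m)`: the first by the maps that extend along `C_0 ⟶ T_{-1}`, the second by the maps that lift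
along `S_{m+1} ⟶ Z_m`. As `T_{-1}` is projective and `S_{m+1}` is injective, each of these
submodules is the set of maps factoring as `C_0 ⟶ T_{-1} ⟶ S_{m+1} ⟶ Z_m`, so they coincide
(`homology_linHomTo_iso_homology_linHomFrom`).

Dimension shifting connects these quotients with the Tate cohomology modules. `Hom(T, -)` is exact
on injectives and `Hom(-, S)` is exact on projectives, so passing to a cosyzygy of the second
argument or a syzygy of the first only shifts degrees. Far out, the syzygies of `W` agree with those
of `T` and the cosyzygies of `V` with those of `S`; shifting out along one complex and back along
the other replaces `M` by `C_0` and `N` by `Z_0`.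

Existence. `gproj` is defined coinductively in any abelian category, so that the injective case is
the projective one in the opposite category. It is closed under extensions, which turns a finite
resolution by such objects into the statement that some iterated syzygy is such an object
(`HasGprojSyzygy.cokernel`). That syzygy has a complete projective complex by splicing
(`exists_isCompleteProjective`), and the comparison map propagates from a syzygy to the object
because `Hom(T, P)` is exact for projective `P` (`TateDatum.nonempty_of_isSyzygy`). -/

lemma shortExact_opcycles {i j : ℤ} (h : j + 1 = i) (hX : X.ExactAt i) :
    (ShortComplex.mk (X.fromOpcycles i j) (X.pOpcycles j) (by
      rw [← cancel_epi (X.pOpcycles i)]; simp)).ShortExact := by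
  have hij : (ComplexShape.down ℤ).Rel i j := h
  have hmono : Mono (X.fromOpcycles i j) :=
    Preadditive.mono_of_isZero_kernel' _
      (X.homologyIsKernel i j ((ComplexShape.down ℤ).next_eq' hij)) hX.isZero_homology
  refine ShortComplex.ShortExact.mk' ?_ hmono inferInstance
  let S' := ShortComplex.mk (X.d i j) (X.pOpcycles j) (by simp)
  let φ : S' ⟶ ShortComplex.mk (X.fromOpcycles i j) (X.pOpcycles j) (by
      rw [← cancel_epi (X.pOpcycles i)]; simp) :=
    { τ₁ := X.pOpcycles i, τ₂ := 𝟙 _, τ₃ := 𝟙 _ }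
  rw [← ShortComplex.exact_iff_of_epi_of_isIso_of_mono φ]
  exact S'.exact_of_g_is_cokernel
    (X.opcyclesIsCokernel i j ((ComplexShape.down ℤ).prev_eq' hij))

lemma shortExact_cycles {i j : ℤ} (h : j + 1 = i) (hX : X.ExactAt j) :
    (ShortComplex.mk (X.iCycles i) (X.toCycles i j) (by
      rw [← cancel_mono (X.iCycles j)]; simp)).ShortExact := by
  have hij : (ComplexShape.down ℤ).Rel i j := h
  have hepi : Epi (X.toCycles i j) :=
    Preadditive.epi_of_isZero_cokernel' _
      (X.homologyIsCokernel i j ((ComplexShape.down ℤ).prev_eq' hij)) hX.isZero_homology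
  refine ShortComplex.ShortExact.mk' ?_ inferInstance hepi
  let S' := ShortComplex.mk (X.iCycles i) (X.d i j) (by simp)
  let φ : ShortComplex.mk (X.iCycles i) (X.toCycles i j) (by
      rw [← cancel_mono (X.iCycles j)]; simp) ⟶ S' :=
    { τ₁ := 𝟙 _, τ₂ := 𝟙 _, τ₃ := X.iCycles j }
  rw [ShortComplex.exact_iff_of_epi_of_isIso_of_mono φ]
  exact S'.exact_of_f_is_kernel
    (X.cyclesIsKernel i j ((ComplexShape.down ℤ).next_eq' hij))

end Syzygies

/-! ### Hom complexes and dimension shifting. -/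

section Hom

variable {R : Type u} [CommRing R]

/-- The complex of modules `Hom(A, S)`. -/
abbrev linHomFrom (A : ModuleCat.{u} R) (S : ChainComplex (ModuleCat.{u} R) ℤ) :=
  (((linearCoyoneda R (ModuleCat.{u} R)).obj (op A)).mapHomologicalComplex
    (ComplexShape.down ℤ)).obj S

/-- The complex of modules `Hom(T, B)`. -/
abbrev linHomTo (T : ChainComplex (ModuleCat.{u} R) ℤ) (B : ModuleCat.{u} R) :=
  (((linearYoneda R (ModuleCat.{u} R)).obj B).mapHomologicalComplex
    (ComplexShape.down ℤ).symm).obj T.op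

/-- The morphism `Hom(B, S) ⟶ Hom(A, S)` induced by `f`. -/
abbrev linHomFromMap {A B : ModuleCat.{u} R} (f : A ⟶ B) (S : ChainComplex (ModuleCat.{u} R) ℤ) :
    linHomFrom B S ⟶ linHomFrom A S :=
  (NatTrans.mapHomologicalComplex ((linearCoyoneda R (ModuleCat.{u} R)).map f.op) _).app S

/-- The morphism `Hom(T, A) ⟶ Hom(T, B)` induced by `f`. -/
abbrev linHomToMap (T : ChainComplex (ModuleCat.{u} R) ℤ) {A B : ModuleCat.{u} R} (f : A ⟶ B) :
    linHomTo T A ⟶ linHomTo T B :=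
  (NatTrans.mapHomologicalComplex ((linearYoneda R (ModuleCat.{u} R)).map f) _).app T.op

lemma shortExact_linHomFrom (S : ChainComplex (ModuleCat.{u} R) ℤ)
    (hS : ∀ n, Injective (S.X n)) (E : ShortComplex (ModuleCat.{u} R)) (hE : E.ShortExact) :
    (ShortComplex.mk (linHomFromMap E.g S) (linHomFromMap E.f S) (by
      ext n (x : E.X₃ ⟶ S.X n); change E.f ≫ E.g ≫ x = 0; simp)).ShortExact := by
  refine HomologicalComplex.shortExact_of_degreewise_shortExact _ fun n => ?_
  have := hE.mono_f
  have := hE.epi_g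
  have := hS n
  refine ModuleCat.shortComplex_shortExact _ (fun (x : E.X₂ ⟶ S.X n) => ⟨fun (h : E.f ≫ x = 0) =>
    ?_, ?_⟩) (fun (x y : E.X₃ ⟶ S.X n) (h : E.g ≫ x = E.g ≫ y) => ?_)
    (fun (x : E.X₁ ⟶ S.X n) => ?_)
  · exact ⟨hE.exact.desc x h, hE.exact.g_desc x h⟩
  · rintro ⟨y : E.X₃ ⟶ S.X n, rfl⟩
    change E.f ≫ E.g ≫ y = 0
    simp
  · rwa [cancel_epi] at h
  · exact ⟨Injective.factorThru x E.f, Injective.comp_factorThru x E.f⟩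

lemma shortExact_linHomTo (T : ChainComplex (ModuleCat.{u} R) ℤ)
    (hT : ∀ n, Projective (T.X n)) (E : ShortComplex (ModuleCat.{u} R)) (hE : E.ShortExact) :
    (ShortComplex.mk (linHomToMap T E.f) (linHomToMap T E.g) (by
      ext n (x : T.X n ⟶ E.X₁); change (x ≫ E.f) ≫ E.g = 0; simp)).ShortExact := by
  refine HomologicalComplex.shortExact_of_degreewise_shortExact _ fun n => ?_
  have := hE.mono_f
  have := hE.epi_g
  have : Projective (unop (T.op.X n)) := hT n
  refine ModuleCat.shortComplex_shortExact _ (fun (x : T.X n ⟶ E.X₂) => ⟨fun (h : x ≫ E.g = 0) =>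
    ?_, ?_⟩) (fun (x y : T.X n ⟶ E.X₁) (h : x ≫ E.f = y ≫ E.f) => ?_)
    (fun (x : T.X n ⟶ E.X₃) => ?_)
  · exact ⟨hE.exact.lift x h, hE.exact.lift_f x h⟩
  · rintro ⟨y : T.X n ⟶ E.X₁, rfl⟩
    change (y ≫ E.f) ≫ E.g = 0
    simp
  · rwa [cancel_mono] at h
  · exact ⟨Projective.factorThru x E.g, Projective.factorThru_comp x E.g⟩

lemma isZero_homology_linHomFrom (P : ModuleCat.{u} R) [Projective P]
    (S : ChainComplex (ModuleCat.{u} R) ℤ) (hS : S.Acyclic) (n : ℤ) :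
    IsZero ((linHomFrom P S).homology n) := by
  rw [← HomologicalComplex.exactAt_iff_isZero_homology,
    HomologicalComplex.exactAt_iff' _ (n + 1) n (n - 1) (by simp) (by simp),
    ShortComplex.moduleCat_exact_iff]
  have h := (S.exactAt_iff' (n + 1) n (n - 1) (by simp) (by simp)).1 (hS n)
  rintro (x : P ⟶ S.X n) (hx : x ≫ S.d n (n - 1) = 0)
  exact ⟨h.liftFromProjective x hx, h.liftFromProjective_comp x hx⟩

lemma isZero_homology_linHomTo (T : ChainComplex (ModuleCat.{u} R) ℤ) (hT : T.Acyclic)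
    (I : ModuleCat.{u} R) [Injective I] (n : ℤ) :
    IsZero ((linHomTo T I).homology n) := by
  rw [← HomologicalComplex.exactAt_iff_isZero_homology,
    HomologicalComplex.exactAt_iff' _ (n - 1) n (n + 1)
      (ComplexShape.prev_eq' _ (sub_add_cancel n 1)) (ComplexShape.next_eq' _ rfl),
    ShortComplex.moduleCat_exact_iff]
  have h := (T.exactAt_iff' (n + 1) n (n - 1) (by simp) (by simp)).1 (hT n)
  rintro (x : T.X n ⟶ I) (hx : T.d (n + 1) n ≫ x = 0)
  exact ⟨h.descToInjective x hx, h.comp_descToInjective x hx⟩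


/-- The homology of `Hom(M, S)` computed through the syzygies of an exact sequence
`⋯ ⟶ W₁ ⟶ W₀ ⟶ M ⟶ 0` of projective modules. -/
lemma homology_linHomFrom_opcycles_iso (S : ChainComplex (ModuleCat.{u} R) ℤ)
    (hS : ∀ n, Injective (S.X n)) (hS' : S.Acyclic) (X : ChainComplex (ModuleCat.{u} R) ℤ)
    (hX : ∀ n, Projective (X.X n)) (i₀ : ℤ) (hX' : ∀ n, i₀ < n → X.ExactAt n) (k : ℤ) (n : ℕ) :
    Nonempty ((linHomFrom (X.opcycles (i₀ + n)) S).homology (k + n) ≅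
      (linHomFrom (X.opcycles i₀) S).homology k) := by
  induction n with
  | zero => exact ⟨eqToIso (by simp)⟩
  | succ n ih =>
    obtain ⟨e⟩ := ih
    have := hX (i₀ + n)
    have hE := shortExact_linHomFrom S hS _ (shortExact_opcycles X (i := i₀ + (n + 1 : ℕ))
      (j := i₀ + n) (by push_cast; ring) (hX' _ (by push_cast; linarith)))
    -- The middle complex is Hom from a projective into an exact complex, so the connecting map is
    -- an isomorphism.
    exact ⟨hE.δIso (k + (n + 1 : ℕ)) (k + n) (by simp [add_assoc])
      (isZero_homology_linHomFrom _ S hS' _) (isZero_homology_linHomFrom _ S hS' _) ≪≫ e⟩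

/-- Dual shift: `Hom(T, -)` of `0 ⟶ Z_i ⟶ Y_i ⟶ Z_{i-1} ⟶ 0` has acyclic middle term because `Y_i`
is injective, so each cosyzygy lowers the cohomological degree by one. -/
lemma homology_linHomTo_cycles_iso (T : ChainComplex (ModuleCat.{u} R) ℤ)
    (hT : ∀ n, Projective (T.X n)) (hT' : T.Acyclic) (Y : ChainComplex (ModuleCat.{u} R) ℤ)
    (hY : ∀ n, Injective (Y.X n)) (i₀ : ℤ) (hY' : ∀ n, n < i₀ → Y.ExactAt n) (k : ℤ) (n : ℕ) :
    Nonempty ((linHomTo T (Y.cycles (i₀ - n))).homology (k - n) ≅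
      (linHomTo T (Y.cycles i₀)).homology k) := by
  induction n with
  | zero => exact ⟨eqToIso (by simp)⟩
  | succ n ih =>
    obtain ⟨e⟩ := ih
    have := hY (i₀ - n)
    have hE := shortExact_linHomTo T hT _ (shortExact_cycles Y (i := i₀ - n)
      (j := i₀ - (n + 1 : ℕ)) (by push_cast; ring) (hY' _ (by push_cast; linarith)))
    exact ⟨hE.δIso (k - (n + 1 : ℕ)) (k - n) (by change _ + 1 = _; push_cast; ring)
      (isZero_homology_linHomTo T hT' _ _) (isZero_homology_linHomTo T hT' _ _) ≪≫ e⟩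

/-- Since `ι` identifies `K` with the cycles and `L` with the boundaries, two complexes with the
same `K` and `L` have isomorphic homology; this is how it is used. -/
lemma homology_iso_quotient (S : ShortComplex (ModuleCat.{u} R)) {K : Type u} [AddCommGroup K]
    [Module R K] (ι : K →ₗ[R] S.X₂) (hι : Function.Injective ι)
    (hι' : ∀ x, S.g x = 0 ↔ ∃ y, ι y = x) (L : Submodule R K)
    (hL : ∀ y, y ∈ L ↔ ∃ x, S.f x = ι y) :
    Nonempty (S.homology ≅ ModuleCat.of R (K ⧸ L)) := by
  have hmem : ∀ y, ι y ∈ LinearMap.ker S.g.hom := fun y => (hι' _).2 ⟨y, rfl⟩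
  let e : K ≃ₗ[R] LinearMap.ker S.g.hom := LinearEquiv.ofBijective (ι.codRestrict _ hmem)
    ⟨fun a b h => hι (congrArg Subtype.val h), fun ⟨x, hx⟩ => by
      obtain ⟨y, rfl⟩ := (hι' x).1 hx
      exact ⟨y, rfl⟩⟩
  refine ⟨S.moduleCatHomologyIso ≪≫ (LinearEquiv.toModuleIso
    (Submodule.Quotient.equiv L (LinearMap.range S.moduleCatToCycles) e ?_)).symm⟩
  ext x
  obtain ⟨y, rfl⟩ := e.surjective x
  simp only [Submodule.mem_map_equiv, LinearEquiv.symm_apply_apply, hL, LinearMap.mem_range]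
  exact exists_congr fun x => ⟨fun h => Subtype.ext h, fun h => congrArg Subtype.val h⟩

end Hom

/-! ### Balance between the two Hom complexes. -/

section Modules

variable {R : Type u} [CommRing R]

lemma homology_linHomTo_iso_homology_linHomFrom
    (T : ChainComplex (ModuleCat.{u} R) ℤ) (hT : ∀ n, Projective (T.X n)) (hT' : T.Acyclic)
    (S : ChainComplex (ModuleCat.{u} R) ℤ) (hS : ∀ n, Injective (S.X n)) (hS' : S.Acyclic)
    (m : ℤ) :
    Nonempty ((linHomTo T (S.cycles m)).homology 0 ≅ (linHomFrom (T.opcycles 0) S).homology m) := by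
  have hE := shortExact_opcycles T (show (-1 : ℤ) + 1 = 0 by simp) (hT' 0)
  have hF := shortExact_cycles S (show m + 1 = m + 1 from rfl) (hS' m)
  have := hE.mono_f
  have := hF.epi_g
  have := hT (-1)
  have := hS (m + 1)
  let L : Submodule R (T.opcycles 0 ⟶ S.cycles m) :=
    LinearMap.range (Linear.leftComp R (S.cycles m) (T.fromOpcycles 0 (-1)))
  -- Extending to `T_{-1}` and lifting to `S_{m+1}` are equivalent: an extension lifts because
  -- `T_{-1}` is projective, and a lift extends because `S_{m+1}` is injective.
  have hL : L = LinearMap.range (Linear.rightComp R (T.opcycles 0) (S.toCycles (m + 1) m)) := by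
    ext f
    constructor
    · rintro ⟨g, rfl⟩
      exact ⟨T.fromOpcycles 0 (-1) ≫ Projective.factorThru g (S.toCycles (m + 1) m), by simp⟩
    · rintro ⟨g, rfl⟩
      exact ⟨Injective.factorThru g (T.fromOpcycles 0 (-1)) ≫ S.toCycles (m + 1) m, by simp⟩
  obtain ⟨e⟩ := homology_iso_quotient ((linHomTo T (S.cycles m)).sc' (-1) 0 1)
    (Linear.leftComp R (S.cycles m) (T.pOpcycles 0))
    (fun (f g : T.opcycles 0 ⟶ S.cycles m) (h : T.pOpcycles 0 ≫ f = T.pOpcycles 0 ≫ g) => by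
      rwa [cancel_epi] at h)
    (fun (x : T.X 0 ⟶ S.cycles m) =>
      ⟨fun (h : T.d 1 0 ≫ x = 0) => ⟨T.descOpcycles x 1 (by simp) h, T.p_descOpcycles x 1 (by simp) h⟩, by
        rintro ⟨y, rfl⟩
        change T.d 1 0 ≫ T.pOpcycles 0 ≫ y = 0
        simp⟩)
    L (fun y => exists_congr fun (x : T.X (-1) ⟶ S.cycles m) => by
      change T.fromOpcycles 0 (-1) ≫ x = y ↔ T.d 0 (-1) ≫ x = T.pOpcycles 0 ≫ y
      rw [← cancel_epi (T.pOpcycles 0)]; simp)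
  obtain ⟨e'⟩ := homology_iso_quotient ((linHomFrom (T.opcycles 0) S).sc' (m + 1) m (m - 1))
    (Linear.rightComp R (T.opcycles 0) (S.iCycles m))
    (fun (f g : T.opcycles 0 ⟶ S.cycles m) (h : f ≫ S.iCycles m = g ≫ S.iCycles m) => by
      rwa [cancel_mono] at h)
    (fun (x : T.opcycles 0 ⟶ S.X m) =>
      ⟨fun (h : x ≫ S.d m (m - 1) = 0) => ⟨S.liftCycles x (m - 1) (by simp) h, S.liftCycles_i x (m - 1) (by simp) h⟩, by
        rintro ⟨y, rfl⟩
        change (y ≫ S.iCycles m) ≫ S.d m (m - 1) = 0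
        simp⟩)
    L (fun y => by
      rw [hL]
      refine exists_congr fun (x : T.opcycles 0 ⟶ S.X (m + 1)) => ?_
      change x ≫ S.toCycles (m + 1) m = y ↔ x ≫ S.d (m + 1) m = y ≫ S.iCycles m
      rw [← cancel_mono (S.iCycles m)]; simp)
  exact ⟨(linHomTo T (S.cycles m)).homologyIsoSc' (-1) 0 1 (ComplexShape.prev_eq' _ (neg_add_cancel 1))
    (ComplexShape.next_eq' _ (zero_add 1)) ≪≫ e ≪≫ e'.symm ≪≫
    ((linHomFrom (T.opcycles 0) S).homologyIsoSc' (m + 1) m (m - 1) (by simp) (by simp)).symm⟩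

end Modules

/-! ### Syzygies under comparison maps, and augmentations. -/

section Abelian

variable {C : Type u} [Category.{v} C] [Abelian C]

lemma isIso_opcyclesMap_of_isIso_f {X Y : ChainComplex C ℤ} (φ : X ⟶ Y) (n : ℤ)
    [IsIso (φ.f n)] [IsIso (φ.f (n + 1))] : IsIso (HomologicalComplex.opcyclesMap φ n) := by
  refine ShortComplex.isIso_opcyclesMap_of_isIso_of_epi' _ ‹_› ?_
  change Epi (φ.f ((ComplexShape.down ℤ).prev n))
  rw [ChainComplex.prev]
  infer_instance

lemma isIso_cyclesMap_of_isIso_f {X Y : ChainComplex C ℤ} (φ : X ⟶ Y) (n : ℤ)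
    [IsIso (φ.f n)] [IsIso (φ.f (n - 1))] : IsIso (HomologicalComplex.cyclesMap φ n) := by
  refine ShortComplex.isIso_cyclesMap_of_isIso_of_mono' _ ‹_› ?_
  change Mono (φ.f ((ComplexShape.down ℤ).next n))
  rw [show (ComplexShape.down ℤ).next n = n - 1 by simp]
  infer_instance

lemma Resolution.exactAt {𝒳 : ObjectProperty C} {M : C} (ρ : Resolution 𝒳 M) {n : ℤ}
    (hn : 0 < n) : ρ.X.ExactAt n := by
  have := ρ.quasiIso
  refine (quasiIsoAt_iff_exactAt' ρ.γ n ?_).1 inferInstance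
  exact HomologicalComplex.exactAt_single_obj _ _ _ _ hn.ne'

lemma Coresolution.exactAt {𝒴 : ObjectProperty C} {N : C} (ρ : Coresolution 𝒴 N) {n : ℤ}
    (hn : n < 0) : ρ.Y.ExactAt n := by
  have := ρ.quasiIso
  refine (quasiIsoAt_iff_exactAt ρ.δ n ?_).1 inferInstance
  exact HomologicalComplex.exactAt_single_obj _ _ _ _ hn.ne

/-- The augmentation identifies `M` with the cokernel of `X₁ ⟶ X₀`. -/
def Resolution.opcyclesIso {𝒳 : ObjectProperty C} {M : C} (ρ : Resolution 𝒳 M) :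
    ρ.X.opcycles 0 ≅ M :=
  have := ρ.quasiIso
  (ρ.X.isoHomologyι 0 (-1) (by simp) ((ρ.isZero (-1) (by simp)).eq_of_tgt _ _)).symm ≪≫
    isoOfQuasiIsoAt ρ.γ 0 ≪≫ HomologicalComplex.singleObjHomologySelfIso _ _ _

/-- The coaugmentation identifies `N` with the kernel of `Y₀ ⟶ Y₋₁`. -/
def Coresolution.cyclesIso {𝒴 : ObjectProperty C} {N : C} (ρ : Coresolution 𝒴 N) :
    ρ.Y.cycles 0 ≅ N :=
  have := ρ.quasiIso
  ρ.Y.isoHomologyπ 1 0 (by simp) ((ρ.isZero 1 (by simp)).eq_of_src _ _) ≪≫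
    (isoOfQuasiIsoAt ρ.δ 0).symm ≪≫ HomologicalComplex.singleObjHomologySelfIso _ _ _

end Abelian

/-! ### Comparison of the two Tate cohomologies. -/

section Modules

variable {R : Type u} [CommRing R]

/-- For an exact complex the shift runs in both directions; when `k` is negative it starts from the
cosyzygy in degree `-k` and descends to degree `0`. -/
lemma homology_linHomTo_cycles_iso_cycles (T : ChainComplex (ModuleCat.{u} R) ℤ)
    (hT : ∀ n, Projective (T.X n)) (hT' : T.Acyclic) (Y : ChainComplex (ModuleCat.{u} R) ℤ)
    (hY : ∀ n, Injective (Y.X n)) (hY' : Y.Acyclic) (k : ℤ) :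
    Nonempty ((linHomTo T (Y.cycles 0)).homology k ≅ (linHomTo T (Y.cycles (-k))).homology 0) := by
  obtain ⟨n, rfl | rfl⟩ := k.eq_nat_or_neg
  · obtain ⟨e⟩ := homology_linHomTo_cycles_iso T hT hT' Y hY 0 (fun n _ => hY' n) n n
    exact ⟨e.symm ≪≫ eqToIso (by simp)⟩
  · obtain ⟨e⟩ := homology_linHomTo_cycles_iso T hT hT' Y hY n (fun n _ => hY' n) 0 n
    exact ⟨eqToIso (by simp) ≪≫ e ≪≫ eqToIso (by simp)⟩

/-- Isomorphic modules give isomorphic cohomology of `Hom(-, S)`. -/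
def homologyLinHomFromIso {A B : ModuleCat.{u} R} (e : A ≅ B)
    (S : ChainComplex (ModuleCat.{u} R) ℤ) (n : ℤ) :
    (linHomFrom A S).homology n ≅ (linHomFrom B S).homology n :=
  (HomologicalComplex.homologyFunctor _ _ n).mapIso ((NatIso.mapHomologicalComplex
    ((linearCoyoneda R (ModuleCat.{u} R)).mapIso e.symm.op) (ComplexShape.down ℤ)).app S)

/-- Isomorphic modules give isomorphic cohomology of `Hom(T, -)`. -/
def homologyLinHomToIso (T : ChainComplex (ModuleCat.{u} R) ℤ) {A B : ModuleCat.{u} R}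
    (e : A ≅ B) (n : ℤ) : (linHomTo T A).homology n ≅ (linHomTo T B).homology n :=
  (HomologicalComplex.homologyFunctor _ _ n).mapIso ((NatIso.mapHomologicalComplex
    ((linearYoneda R (ModuleCat.{u} R)).mapIso e) (ComplexShape.down ℤ).symm).app T.op)

/-- The two Tate cohomologies agree in every degree: by dimension shifting, both are the quotient of
`Hom(Coker (T₁ ⟶ T₀), Ker (S₋ₙ ⟶ S₋ₙ₋₁))` by the morphisms that extend to `T₋₁`, equivalently
that lift to `S₋ₙ₊₁`. No Gorenstein hypothesis on `R` is needed. -/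
lemma tateExt_iso {M N : ModuleCat.{u} R} (τ : TateProjectiveResolution M)
    (σ : TateInjectiveCoresolution N) (n : ℤ) : Nonempty (τ.tateExt N n ≅ σ.tateExt M n) := by
  have hT := τ.totallyAcyclic.mem
  have hT' := τ.totallyAcyclic.acyclic
  have hS := σ.totallyAcyclic.mem
  have hS' := σ.totallyAcyclic.acyclic
  have hW : ∀ n, Projective (τ.W.X.X n) := fun n => by
    by_cases hn : 0 ≤ n
    · exact τ.W.mem n hn
    · exact (τ.W.isZero n (by omega)).projective
  have hV : ∀ n, Injective (σ.V.Y.X n) := fun n => by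
    by_cases hn : n ≤ 0
    · exact σ.V.mem n hn
    · exact (σ.V.isZero n (by omega)).injective
  obtain ⟨n₀, h₀⟩ := τ.isIso
  obtain ⟨n₁, h₁⟩ := σ.isIso
  -- `a` and `b` are how far one must go out for `α` and `β` to be isomorphisms; they are
  -- nonnegative because `W` is only known to be exact in positive degrees and `V` in negative ones.
  obtain ⟨a, ha⟩ := Int.eq_ofNat_of_zero_le (le_max_left 0 n₀)
  obtain ⟨b, hb⟩ := Int.eq_ofNat_of_zero_le (le_max_left 0 (-n₁))
  have ea : IsIso (HomologicalComplex.opcyclesMap τ.α (0 + a)) := by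
    have := h₀ (0 + a) (by omega)
    have := h₀ (0 + a + 1) (by omega)
    exact isIso_opcyclesMap_of_isIso_f τ.α (0 + a)
  have eb : IsIso (HomologicalComplex.cyclesMap σ.β (0 - b)) := by
    have := h₁ (0 - b) (by omega)
    have := h₁ (0 - b - 1) (by omega)
    exact isIso_cyclesMap_of_isIso_f σ.β (0 - b)
  obtain ⟨e₁⟩ := homology_linHomFrom_opcycles_iso σ.S hS hS' τ.T hT 0 (fun n _ => hT' n) (-n) a
  obtain ⟨e₂⟩ := homology_linHomFrom_opcycles_iso σ.S hS hS' τ.W.X hW 0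
    (fun n hn => τ.W.exactAt hn) (-n) a
  obtain ⟨e₃⟩ := homology_linHomTo_cycles_iso τ.T hT hT' σ.S hS 0 (fun n _ => hS' n) n b
  obtain ⟨e₄⟩ := homology_linHomTo_cycles_iso τ.T hT hT' σ.V.Y hV 0
    (fun n hn => σ.V.exactAt hn) n b
  obtain ⟨e₅⟩ := homology_linHomTo_cycles_iso_cycles τ.T hT hT' σ.S hS hS' n
  obtain ⟨e₆⟩ := homology_linHomTo_iso_homology_linHomFrom τ.T hT hT' σ.S hS hS' (-n)
  -- The second argument goes `N`, `Z_{-b} V`, `Z_{-b} S`, `Z_0 S`, `Z_{-n} S`; after balancing, the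
  -- first goes `C_0 T`, `C_a T`, `C_a W`, `M`.
  exact ⟨homologyLinHomToIso τ.T σ.V.cyclesIso.symm n ≪≫ e₄.symm ≪≫
    homologyLinHomToIso τ.T (asIso (HomologicalComplex.cyclesMap σ.β (0 - b))) _ ≪≫ e₃ ≪≫
    e₅ ≪≫ e₆ ≪≫ e₁.symm ≪≫
    homologyLinHomFromIso (asIso (HomologicalComplex.opcyclesMap τ.α (0 + a))) _ _ ≪≫ e₂ ≪≫
    homologyLinHomFromIso τ.W.opcyclesIso _ _⟩

end Modules

/-! ### Extensions, syzygies and Gorenstein projective objects in an abelian category. -/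

section Abelian

open scoped ZeroObject

variable {C : Type u} [Category.{v} C] [Abelian C]

/-- The pullback of an extension along `f`. -/
lemma shortExact_pullback {S : ShortComplex C} (hS : S.ShortExact) {D : C} (f : D ⟶ S.X₃) :
    (ShortComplex.mk (pullback.lift S.f 0 (by simp) : S.X₁ ⟶ pullback S.g f)
      (pullback.snd S.g f) (pullback.lift_snd _ _ _)).ShortExact := by
  have := hS.mono_f
  have := hS.epi_g
  have hmono : Mono (pullback.lift S.f 0 (by simp) : S.X₁ ⟶ pullback S.g f) :=
    mono_of_mono_fac (pullback.lift_fst _ _ _)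
  refine ShortComplex.ShortExact.mk' (ShortComplex.exact_of_f_is_kernel _ ?_) hmono inferInstance
  refine KernelFork.IsLimit.ofι' _ _ fun {A} k (hk : k ≫ pullback.snd S.g f = 0) => ?_
  have h : (k ≫ pullback.fst S.g f) ≫ S.g = 0 := by
    rw [Category.assoc, pullback.condition, reassoc_of% hk, zero_comp]
  refine ⟨hS.exact.lift _ h, ?_⟩
  apply pullback.hom_ext
  · exact (Category.assoc _ _ _).trans ((congrArg _ (pullback.lift_fst _ _ _)).trans
      (hS.exact.lift_f _ h))
  · exact (Category.assoc _ _ _).trans ((congrArg _ (pullback.lift_snd _ _ _)).trans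
      (comp_zero.trans hk.symm))

/-- If `D` is the kernel of an epimorphism `r` out of the quotient `S.X₃` of `S.X₂`, then the
preimage of `D` is the kernel of the composition `S.X₂ ⟶ S.X₃ ⟶ Z`. -/
lemma shortExact_pullback_comp {S : ShortComplex C} (hS : S.ShortExact) {D Z : C} (f : D ⟶ S.X₃)
    (r : S.X₃ ⟶ Z) (w : f ≫ r = 0) (h : (ShortComplex.mk f r w).ShortExact) :
    (ShortComplex.mk (pullback.fst S.g f) (S.g ≫ r)
      (by rw [pullback.condition_assoc, w, comp_zero])).ShortExact := by
  have := hS.epi_g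
  have : Mono f := h.mono_f
  have : Epi r := h.epi_g
  refine ShortComplex.ShortExact.mk' (ShortComplex.exact_of_f_is_kernel _ ?_)
    inferInstance (epi_comp _ _)
  refine KernelFork.IsLimit.ofι' _ _ fun {A} k (hk : k ≫ S.g ≫ r = 0) => ?_
  have hk' : (k ≫ S.g) ≫ r = 0 := by rw [Category.assoc, hk]
  exact ⟨pullback.lift k (h.exact.lift _ hk') (h.exact.lift_f _ hk').symm, pullback.lift_fst _ _ _⟩

lemma ShortExact.of_isos {S : ShortComplex C} (hS : S.ShortExact) {A B : C} (a : A ≅ S.X₁)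
    (b : S.X₃ ≅ B) : (ShortComplex.mk (a.hom ≫ S.f) (S.g ≫ b.hom) (by simp)).ShortExact :=
  ShortComplex.shortExact_of_iso (ShortComplex.isoMk a.symm (Iso.refl _) b) hS

/-- The snake diagram of a morphism between short exact sequences. -/
def snakeInputOfShortExact {S S' : ShortComplex C} (hS : S.ShortExact) (hS' : S'.ShortExact)
    (φ : S ⟶ S') : ShortComplex.SnakeInput C where
  L₀ := kernel φ
  L₁ := S
  L₂ := S'
  L₃ := cokernel φ
  v₀₁ := kernel.ι φ
  v₁₂ := φ
  v₂₃ := cokernel.π φ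
  w₀₂ := kernel.condition φ
  w₁₃ := cokernel.condition φ
  h₀ := kernelIsKernel φ
  h₃ := cokernelIsCokernel φ
  L₁_exact := hS.exact
  epi_L₁_g := hS.epi_g
  L₂_exact := hS'.exact
  mono_L₂_f := hS'.mono_f

/-- Snake lemma: the cokernel of `φ.τ₁` vanishes, so the row of kernels is right exact too. -/
lemma exists_shortExact_kernels {S S' : ShortComplex C} (hS : S.ShortExact) (hS' : S'.ShortExact)
    (φ : S ⟶ S') (h₁ : Epi φ.τ₁) (h₃ : Epi φ.τ₃) :
    ∃ (K : ShortComplex C) (ψ : K ⟶ S) (w : ψ ≫ φ = 0), K.ShortExact ∧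
      (ShortComplex.mk ψ.τ₁ φ.τ₁ (by rw [← ShortComplex.comp_τ₁, w]; rfl)).ShortExact ∧
      (ShortComplex.mk ψ.τ₂ φ.τ₂ (by rw [← ShortComplex.comp_τ₂, w]; rfl)).ShortExact ∧
      (ShortComplex.mk ψ.τ₃ φ.τ₃ (by rw [← ShortComplex.comp_τ₃, w]; rfl)).ShortExact := by
  let D := snakeInputOfShortExact hS hS' φ
  have : Mono D.L₁.f := hS.mono_f
  have := hS.epi_g
  have := hS'.epi_g
  have h₂ : Epi φ.τ₂ := ShortComplex.epi_τ₂_of_exact_of_epi φ hS'.exact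
  have hz : IsZero D.L₃.X₁ := by
    have : Epi D.v₁₂.τ₁ := h₁
    have h0 : D.v₂₃.τ₁ = 0 := zero_of_epi_comp D.v₁₂.τ₁ D.w₁₃_τ₁
    rw [IsZero.iff_id_eq_zero, ← cancel_epi D.v₂₃.τ₁, h0]
    simp
  have hepi : Epi D.L₀.g := D.L₁'_exact.epi_f (hz.eq_of_tgt _ _)
  exact ⟨D.L₀, D.v₀₁, D.w₀₂, .mk' D.L₀_exact inferInstance hepi,
    .mk' D.exact_C₁_up (inferInstanceAs (Mono D.v₀₁.τ₁)) h₁,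
    .mk' D.exact_C₂_up (inferInstanceAs (Mono D.v₀₁.τ₂)) h₂,
    .mk' D.exact_C₃_up (inferInstanceAs (Mono D.v₀₁.τ₃)) h₃⟩

lemma exists_shortExact_cokernels {S S' : ShortComplex C} (hS : S.ShortExact)
    (hS' : S'.ShortExact) (φ : S ⟶ S') (h₁ : Mono φ.τ₁) (h₃ : Mono φ.τ₃) :
    ∃ (K : ShortComplex C) (ψ : S' ⟶ K) (w : φ ≫ ψ = 0), K.ShortExact ∧
      (ShortComplex.mk φ.τ₁ ψ.τ₁ (by rw [← ShortComplex.comp_τ₁, w]; rfl)).ShortExact ∧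
      (ShortComplex.mk φ.τ₂ ψ.τ₂ (by rw [← ShortComplex.comp_τ₂, w]; rfl)).ShortExact ∧
      (ShortComplex.mk φ.τ₃ ψ.τ₃ (by rw [← ShortComplex.comp_τ₃, w]; rfl)).ShortExact := by
  let D := snakeInputOfShortExact hS hS' φ
  have : Epi D.L₂.g := hS'.epi_g
  have := hS.mono_f
  have := hS'.mono_f
  have h₂ : Mono φ.τ₂ := ShortComplex.mono_τ₂_of_exact_of_mono φ hS.exact
  have hz : IsZero D.L₀.X₃ := by
    have : Mono D.v₁₂.τ₃ := h₃
    have h0 : D.v₀₁.τ₃ = 0 := zero_of_comp_mono D.v₁₂.τ₃ D.w₀₂_τ₃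
    rw [IsZero.iff_id_eq_zero, ← cancel_mono D.v₀₁.τ₃, h0]
    simp
  have hmono : Mono D.L₃.f := D.L₂'_exact.mono_g (hz.eq_of_src _ _)
  exact ⟨D.L₃, D.v₂₃, D.w₁₃, .mk' D.L₃_exact hmono inferInstance,
    .mk' D.exact_C₁_down h₁ (inferInstanceAs (Epi D.v₂₃.τ₁)),
    .mk' D.exact_C₂_down h₂ (inferInstanceAs (Epi D.v₂₃.τ₂)),
    .mk' D.exact_C₃_down h₃ (inferInstanceAs (Epi D.v₂₃.τ₃))⟩

/-- `A` is the kernel of an epimorphism from a projective object to `B`. -/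
def IsSyzygy (A B : C) : Prop :=
  ∃ (P : C) (i : A ⟶ P) (p : P ⟶ B) (w : i ≫ p = 0),
    Projective P ∧ (ShortComplex.mk i p w).ShortExact

lemma IsSyzygy.of_isos {A A' B B' : C} (h : IsSyzygy A B) (a : A' ≅ A) (b : B ≅ B') :
    IsSyzygy A' B' := by
  obtain ⟨P, i, p, w, hP, h⟩ := h
  exact ⟨P, _, _, _, hP, ShortExact.of_isos h a b⟩

/-- Morphisms to projective objects extend along monomorphisms with cokernel `B`, that is,
`Ext¹(B, Q) = 0` for each projective object `Q`. -/
def IsLeftOrthogonal (B : C) : Prop :=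
  ∀ ⦃A E : C⦄ (i : A ⟶ E) (p : E ⟶ B) (w : i ≫ p = 0), (ShortComplex.mk i p w).ShortExact →
    ∀ ⦃Q : C⦄, Projective Q → ∀ f : A ⟶ Q, ∃ g : E ⟶ Q, i ≫ g = f

lemma IsLeftOrthogonal.of_iso {B B' : C} (h : IsLeftOrthogonal B) (b : B ≅ B') :
    IsLeftOrthogonal B' := fun _ _ _ _ _ hE _ hQ f =>
  h _ _ _ (ShortExact.of_isos hE (Iso.refl _) b.symm) hQ f |>.imp fun _ hg => by simpa using hg

/-- The extension is made in two stages: first to the preimage of `S.X₁` in `E`, an extension of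
`S.X₁` by `A`, and then to `E`, whose quotient by that preimage is `S.X₃`. -/
lemma IsLeftOrthogonal.of_extension {S : ShortComplex C} (hS : S.ShortExact)
    (h₁ : IsLeftOrthogonal S.X₁) (h₃ : IsLeftOrthogonal S.X₃) : IsLeftOrthogonal S.X₂ := by
  intro A E i p w hE Q hQ f
  obtain ⟨g, hg⟩ := h₁ _ _ _ (shortExact_pullback hE S.f) hQ f
  obtain ⟨k, hk⟩ := h₃ _ _ _ (shortExact_pullback_comp hE S.f S.g S.zero hS) hQ g
  refine ⟨k, ?_⟩
  rw [← hg, ← hk]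
  exact ((pullback.lift_fst_assoc _ _ _ _).symm)

/-- It suffices to extend along one projective presentation. -/
lemma isLeftOrthogonal_of_presentation {S : ShortComplex C} (hS : S.ShortExact)
    (hP : Projective S.X₂)
    (h : ∀ ⦃Q : C⦄, Projective Q → ∀ f : S.X₁ ⟶ Q, ∃ g : S.X₂ ⟶ Q, S.f ≫ g = f) :
    IsLeftOrthogonal S.X₃ := by
  intro A E i p w hE Q hQ f
  have : Mono i := hE.mono_f
  have : Epi p := hE.epi_g
  have := hS.mono_f
  let s : S.X₂ ⟶ E := Projective.factorThru S.g p
  have hs : s ≫ p = S.g := Projective.factorThru_comp _ _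
  obtain ⟨t, ht⟩ : ∃ t : S.X₁ ⟶ A, t ≫ i = S.f ≫ s :=
    ⟨hE.exact.lift (S.f ≫ s) (by simp [hs]), hE.exact.lift_f _ _⟩
  obtain ⟨h, hh⟩ := h hQ (t ≫ f)
  -- `E` is the pushout of `A` and `S.X₂` over `S.X₁`: the kernel of `A ⊞ S.X₂ ⟶ E` consists of the
  -- pairs `(-t u, S.f u)`, which `(f, h)` kills, so `f` and `h` glue to a map on `E`.
  have hepi : Epi (biprod.desc i s) := Preadditive.epi_of_cancel_zero _ fun {Z} x hx => by
    have hx₁ : i ≫ x = 0 := by simpa using biprod.inl ≫= hx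
    have hx₂ : s ≫ x = 0 := by simpa using biprod.inr ≫= hx
    obtain ⟨y, rfl⟩ := hE.exact.desc' x hx₁
    have := hS.epi_g
    change s ≫ p ≫ y = 0 at hx₂
    have hy : y = 0 := by rw [← cancel_epi S.g, ← hs, Category.assoc, hx₂, comp_zero]
    simp [hy]
  have hker : kernel.ι (biprod.desc i s) ≫ biprod.desc f h = 0 := by
    set κ := kernel.ι (biprod.desc i s)
    have hκ : κ ≫ biprod.fst ≫ i + κ ≫ biprod.snd ≫ s = 0 := by
      rw [← Preadditive.comp_add, ← biprod.desc_eq]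
      exact kernel.condition _
    have h1 : (κ ≫ biprod.snd) ≫ S.g = 0 := by
      have := hκ =≫ p
      simpa [w, hs] using this
    obtain ⟨u, hu⟩ : ∃ u, u ≫ S.f = κ ≫ biprod.snd := ⟨hS.exact.lift _ h1, hS.exact.lift_f _ _⟩
    have h2 : κ ≫ biprod.fst = - (u ≫ t) := by
      rw [← cancel_mono i, Category.assoc, eq_neg_of_add_eq_zero_left hκ, Preadditive.neg_comp,
        Category.assoc, ht, reassoc_of% hu]
    have h3 : biprod.desc f h = biprod.fst ≫ f + biprod.snd ≫ h := biprod.desc_eq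
    rw [h3, Preadditive.comp_add, reassoc_of% h2, ← reassoc_of% hu, hh]
    simp
  refine ⟨(Abelian.epiIsCokernelOfKernel _ (kernelIsKernel (biprod.desc i s))).desc
    (CokernelCofork.ofπ _ hker), ?_⟩
  have := (Abelian.epiIsCokernelOfKernel _ (kernelIsKernel (biprod.desc i s))).fac
    (CokernelCofork.ofπ _ hker) WalkingParallelPair.one
  simpa using biprod.inl ≫= this

/-- Classes of objects in the left orthogonal of the projective objects that are closed under
forming some syzygy and some cosyzygy. -/
structure IsGorensteinProjectiveClass (𝒢 : ObjectProperty C) : Prop where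
  exists_syzygy : ∀ B, 𝒢 B → ∃ A, 𝒢 A ∧ IsSyzygy A B
  exists_cosyzygy : ∀ A, 𝒢 A → ∃ B, 𝒢 B ∧ IsSyzygy A B
  orthogonal : ∀ B, 𝒢 B → IsLeftOrthogonal B

variable (C) in
/-- The largest Gorenstein projective class. -/
def gproj : ObjectProperty C := fun G => ∃ 𝒢, IsGorensteinProjectiveClass 𝒢 ∧ 𝒢 G

variable (C) in
lemma isGorensteinProjectiveClass_gproj : IsGorensteinProjectiveClass (gproj C) where
  exists_syzygy := fun B ⟨𝒢, h𝒢, hB⟩ =>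
    (h𝒢.exists_syzygy B hB).imp fun _ ⟨hA, h⟩ => ⟨⟨𝒢, h𝒢, hA⟩, h⟩
  exists_cosyzygy := fun B ⟨𝒢, h𝒢, hB⟩ =>
    (h𝒢.exists_cosyzygy B hB).imp fun _ ⟨hA, h⟩ => ⟨⟨𝒢, h𝒢, hA⟩, h⟩
  orthogonal := fun B ⟨_, h𝒢, hB⟩ => h𝒢.orthogonal B hB

/-- The classes are not assumed closed under isomorphism, but the isomorphism closure of `gproj C`
is again such a class. -/
lemma gproj_of_iso {A B : C} (e : A ≅ B) (hA : gproj C A) : gproj C B := by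
  have h := isGorensteinProjectiveClass_gproj C
  refine ⟨fun X => ∃ Y, gproj C Y ∧ Nonempty (Y ≅ X), ⟨?_, ?_, ?_⟩, A, hA, ⟨e⟩⟩
  · rintro X ⟨Y, hY, ⟨e⟩⟩
    obtain ⟨Z, hZ, hZY⟩ := h.exists_syzygy Y hY
    exact ⟨Z, ⟨Z, hZ, ⟨Iso.refl _⟩⟩, hZY.of_isos (Iso.refl _) e⟩
  · rintro X ⟨Y, hY, ⟨e⟩⟩
    obtain ⟨Z, hZ, hZY⟩ := h.exists_cosyzygy Y hY
    exact ⟨Z, ⟨Z, hZ, ⟨Iso.refl _⟩⟩, hZY.of_isos e.symm (Iso.refl _)⟩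
  · rintro X ⟨Y, hY, ⟨e⟩⟩
    exact (h.orthogonal Y hY).of_iso e

lemma gproj_of_projective (P : C) (hP : Projective P) : gproj C P := by
  refine ⟨fun X => Projective X, ⟨fun B hB => ⟨0, inferInstance, B, (0 : (0 : C) ⟶ B), 𝟙 B, by simp, hB, ?_⟩,
    fun A hA => ⟨0, inferInstance, A, 𝟙 A, (0 : A ⟶ (0 : C)), by simp, hA, ?_⟩, ?_⟩, hP⟩
  · exact (ShortComplex.Splitting.ofIsZeroOfIsIso (ShortComplex.mk (0 : (0 : C) ⟶ B) (𝟙 B) (by simp))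
      (isZero_zero C) inferInstance).shortExact
  · exact (ShortComplex.Splitting.ofIsIsoOfIsZero (ShortComplex.mk (𝟙 A) (0 : A ⟶ (0 : C)) (by simp))
      inferInstance (isZero_zero C)).shortExact
  · intro B hB A E i p w hE Q _ f
    have : Projective (ShortComplex.mk i p w).X₃ := hB
    exact ⟨hE.splittingOfProjective.r ≫ f, by
      have := hE.splittingOfProjective.f_r
      dsimp at this
      rw [reassoc_of% this]⟩

/-- The extensions of `gproj` objects by `gproj` objects form a Gorenstein projective class.
Syzygies come from the horseshoe lemma. For cosyzygies, orthogonality of the quotient `B` extends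
the embedding `A ⟶ P` to the middle term. -/
lemma gproj_of_extension {S : ShortComplex C} (hS : S.ShortExact) (h₁ : gproj C S.X₁)
    (h₃ : gproj C S.X₃) : gproj C S.X₂ := by
  have h := isGorensteinProjectiveClass_gproj C
  refine ⟨fun X => ∃ (A B : C) (i : A ⟶ X) (p : X ⟶ B) (w : i ≫ p = 0),
    (ShortComplex.mk i p w).ShortExact ∧ gproj C A ∧ gproj C B, ⟨?_, ?_, ?_⟩,
    _, _, _, _, _, hS, h₁, h₃⟩
  · rintro X ⟨A, B, i, p, w, hX, hA, hB⟩
    obtain ⟨A', hA', P, j, q, wP, hP, hPA⟩ := h.exists_syzygy A hA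
    obtain ⟨B', hB', Q, k, r, wQ, hQ, hQB⟩ := h.exists_syzygy B hB
    have : Epi p := hX.epi_g
    let φ : ShortComplex.mk (biprod.inl : P ⟶ P ⊞ Q) biprod.snd (by simp) ⟶
        ShortComplex.mk i p w :=
      { τ₁ := q
        τ₂ := biprod.desc (q ≫ i) (Projective.factorThru r p)
        τ₃ := r
        comm₁₂ := by simp
        comm₂₃ := by ext <;> simp [w] }
    obtain ⟨K, ψ, w', hK, e₁, e₂, e₃⟩ := exists_shortExact_kernels
      (ShortComplex.Splitting.ofHasBinaryBiproduct P Q).shortExact hX φ hPA.epi_g hQB.epi_g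
    exact ⟨K.X₂, ⟨_, _, _, _, _, hK,
      gproj_of_iso (hPA.fIsKernel.conePointUniqueUpToIso e₁.fIsKernel) hA',
      gproj_of_iso (hQB.fIsKernel.conePointUniqueUpToIso e₃.fIsKernel) hB'⟩,
      _, _, _, _, inferInstance, e₂⟩
  · rintro X ⟨A, B, i, p, w, hX, hA, hB⟩
    obtain ⟨A', hA', P, j, q, wP, hP, hPA⟩ := h.exists_cosyzygy A hA
    obtain ⟨B', hB', Q, k, r, wQ, hQ, hQB⟩ := h.exists_cosyzygy B hB
    obtain ⟨g, hg⟩ := h.orthogonal B hB _ _ _ hX hP j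
    let φ : ShortComplex.mk i p w ⟶
        ShortComplex.mk (biprod.inl : P ⟶ P ⊞ Q) biprod.snd (by simp) :=
      { τ₁ := j
        τ₂ := biprod.lift g (p ≫ k)
        τ₃ := k
        comm₁₂ := by ext <;> simp [hg, reassoc_of% w]
        comm₂₃ := by simp }
    obtain ⟨K, ψ, w', hK, e₁, e₂, e₃⟩ := exists_shortExact_cokernels hX
      (ShortComplex.Splitting.ofHasBinaryBiproduct P Q).shortExact φ hPA.mono_f hQB.mono_f
    exact ⟨K.X₂, ⟨_, _, _, _, _, hK,
      gproj_of_iso (hPA.gIsCokernel.coconePointUniqueUpToIso e₁.gIsCokernel) hA',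
      gproj_of_iso (hQB.gIsCokernel.coconePointUniqueUpToIso e₃.gIsCokernel) hB'⟩,
      _, _, _, _, inferInstance, e₂⟩
  · rintro X ⟨A, B, i, p, w, hX, hA, hB⟩
    exact .of_extension hX (h.orthogonal A hA) (h.orthogonal B hB)

/-- Objects with a finite resolution by Gorenstein projective objects. -/
inductive HasFiniteGprojResolution : C → Prop
  | of_gproj {G : C} (hG : gproj C G) : HasFiniteGprojResolution G
  | step {K G M : C} (i : K ⟶ G) (p : G ⟶ M) (w : i ≫ p = 0)
      (h : (ShortComplex.mk i p w).ShortExact) (hK : HasFiniteGprojResolution K)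
      (hG : gproj C G) : HasFiniteGprojResolution M

/-- Objects of which some iterated syzygy is Gorenstein projective. -/
inductive HasGprojSyzygy : C → Prop
  | of_gproj {G : C} (hG : gproj C G) : HasGprojSyzygy G
  | step {K M : C} (h : IsSyzygy K M) (hK : HasGprojSyzygy K) : HasGprojSyzygy M

/-- Cover `G` by a projective `P` with kernel `G'` in `gproj`. The syzygy of `M` is then `L = P ×_G
K`, an extension of `K` by `G'`. If `K` is in `gproj`, so is `L`. Otherwise a presentation `K' ⟶ Q ⟶
K` pulls back to `K' ⟶ L ×_K Q ⟶ L`, whose middle term is an extension of `Q` by `G'`, and induction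
applies to `K'`. -/
lemma HasGprojSyzygy.cokernel {K : C} (hK : HasGprojSyzygy K) : ∀ {G M : C} (i : K ⟶ G)
    (p : G ⟶ M) (w : i ≫ p = 0), (ShortComplex.mk i p w).ShortExact → gproj C G →
      HasGprojSyzygy M := by
  have hc := isGorensteinProjectiveClass_gproj C
  induction hK with
  | of_gproj hK =>
    intro G M i p w h hG
    obtain ⟨G', hG', P, j, q, w', hP, hPG⟩ := hc.exists_syzygy G hG
    exact .step ⟨P, _, _, _, hP, shortExact_pullback_comp hPG i p w h⟩
      (.of_gproj (gproj_of_extension (shortExact_pullback hPG i) hG' hK))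
  | @step K' K hK' _ ih =>
    intro G M i p w h hG
    obtain ⟨G', hG', P, j, q, w', hP, hPG⟩ := hc.exists_syzygy G hG
    obtain ⟨Q, k, r, wQ, hQ, hQK⟩ := hK'
    refine .step ⟨P, _, _, _, hP, shortExact_pullback_comp hPG i p w h⟩ ?_
    have hL := shortExact_pullback hPG i
    exact ih _ _ _ (shortExact_pullback hQK (pullback.snd q i))
      (gproj_of_iso (pullbackSymmetry _ _)
        (gproj_of_extension (shortExact_pullback hL r) hG' (gproj_of_projective Q hQ)))

lemma HasFiniteGprojResolution.hasGprojSyzygy {M : C} (h : HasFiniteGprojResolution M) :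
    HasGprojSyzygy M := by
  induction h with
  | of_gproj hG => exact .of_gproj hG
  | step i p w h _ hG ih => exact ih.cokernel i p w h hG

end Abelian

/-- Dependent choice in both directions. -/
lemma exists_int_seq {α : Type*} (p : α → Prop) (r : α → α → Prop)
    (hl : ∀ b, p b → ∃ a, p a ∧ r a b) (hr : ∀ a, p a → ∃ b, p b ∧ r a b) (x : α) (hx : p x) :
    ∃ z : ℤ → α, z 0 = x ∧ (∀ n, p (z n)) ∧ ∀ n, r (z (n + 1)) (z n) := by
  choose l hl using hl
  choose s hs using hr
  let L : ℕ → {a // p a} := fun n =>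
    Nat.rec ⟨x, hx⟩ (fun _ a => ⟨l a.1 a.2, (hl a.1 a.2).1⟩) n
  let S : ℕ → {a // p a} := fun n =>
    Nat.rec ⟨x, hx⟩ (fun _ a => ⟨s a.1 a.2, (hs a.1 a.2).1⟩) n
  refine ⟨fun | .ofNat n => (L n).1 | .negSucc n => (S (n + 1)).1, rfl, ?_, ?_⟩
  · rintro (n | n)
    exacts [(L n).2, (S (n + 1)).2]
  · rintro (n | n)
    · exact (hl (L n).1 (L n).2).2
    · cases n with
      | zero => exact (hs (S 0).1 (S 0).2).2
      | succ n => exact (hs (S (n + 1)).1 (S (n + 1)).2).2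

/-! ### Complete projective complexes and construction of Tate data. -/

section Abelian

open scoped ZeroObject

variable {C : Type u} [Category.{v} C] [Abelian C]

/-- Exact complexes of projective objects such that `Hom(-, Q)` is exact on them for each
projective object `Q`. -/
structure IsCompleteProjective (T : ChainComplex C ℤ) : Prop where
  projective : ∀ n, Projective (T.X n)
  acyclic : T.Acyclic
  exists_extension : ∀ i j k : ℤ, j + 1 = i → k + 1 = j → ∀ Q : C, Projective Q →
    ∀ f : T.X j ⟶ Q, T.d i j ≫ f = 0 → ∃ g : T.X k ⟶ Q, T.d j k ≫ g = f

lemma exactAt_iff_of_eq (X : ChainComplex C ℤ) {i j k : ℤ} (hi : j + 1 = i) (hk : k + 1 = j) :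
    X.ExactAt j ↔ (ShortComplex.mk (X.d i j) (X.d j k) (X.d_comp_d _ _ _)).Exact :=
  X.exactAt_iff' i j k (by simp [hi]) (by simp [← hk])

lemma exact_comp_mono {A X Y B : C} (f : A ⟶ X) (p : X ⟶ Y) (i : Y ⟶ B) (w : f ≫ p = 0)
    (h : (ShortComplex.mk f p w).Exact) [Mono i] :
    (ShortComplex.mk f (p ≫ i) (by rw [reassoc_of% w, zero_comp])).Exact := by
  let φ : ShortComplex.mk f p w ⟶ ShortComplex.mk f (p ≫ i) (by rw [reassoc_of% w, zero_comp]) :=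
    { τ₁ := 𝟙 _, τ₂ := 𝟙 _, τ₃ := i }
  exact (ShortComplex.exact_iff_of_epi_of_isIso_of_mono φ).1 h

lemma exact_epi_comp {X Y B D : C} (p : X ⟶ Y) (i : Y ⟶ B) (g : B ⟶ D) (w : i ≫ g = 0)
    (h : (ShortComplex.mk i g w).Exact) [Epi p] :
    (ShortComplex.mk (p ≫ i) g (by rw [Category.assoc, w, comp_zero])).Exact := by
  let φ : ShortComplex.mk (p ≫ i) g (by rw [Category.assoc, w, comp_zero]) ⟶
      ShortComplex.mk i g w :=
    { τ₁ := p, τ₂ := 𝟙 _, τ₃ := 𝟙 _ }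
  exact (ShortComplex.exact_iff_of_epi_of_isIso_of_mono φ).2 h

/-- Syzygies and cosyzygies are chosen in both directions from `G`, and the short exact sequences
`Z_{n+1} ⟶ X_n ⟶ Z_n` are spliced. -/
lemma exists_isCompleteProjective {G : C} (hG : gproj C G) :
    ∃ (T : ChainComplex C ℤ) (p : T.X 0 ⟶ G) (w : T.d 1 0 ≫ p = 0), IsCompleteProjective T ∧
      Epi p ∧ (ShortComplex.mk (T.d 1 0) p w).Exact := by
  have hc := isGorensteinProjectiveClass_gproj C
  obtain ⟨Z, rfl, hZ, hr⟩ := exists_int_seq _ _ hc.exists_syzygy hc.exists_cosyzygy G hG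
  choose X i p w hX hE using hr
  have hmono : ∀ n, Mono (i n) := fun n => (hE n).mono_f
  have hepi : ∀ n, Epi (p n) := fun n => (hE n).epi_g
  let T : ChainComplex C ℤ := ChainComplex.of X (fun n => p (n + 1) ≫ i n)
    (fun n => by rw [Category.assoc, reassoc_of% (w (n + 1)), zero_comp, comp_zero])
  have hd : ∀ n, T.d (n + 1) n = p (n + 1) ≫ i n := fun n =>
    ChainComplex.of_d X (fun n => p (n + 1) ≫ i n) n
  refine ⟨T, p 0, ?_, ⟨hX, fun n => ?_, ?_⟩, hepi 0, ?_⟩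
  · change T.d (0 + 1) 0 ≫ p 0 = 0
    rw [hd, Category.assoc, w, comp_zero]
  · obtain ⟨m, rfl⟩ : ∃ m, n = m + 1 := ⟨n - 1, by simp⟩
    rw [exactAt_iff_of_eq T rfl rfl]
    simp only [hd]
    exact exact_epi_comp _ _ _ _ (exact_comp_mono _ _ _ _ (hE (m + 1)).exact)
  · rintro _ _ k rfl rfl Q hQ f hf
    rw [hd, Category.assoc] at hf
    -- `f` factors through `Z_{k+1}`, and the factor extends along `Z_{k+1} ⟶ X_k` because the
    -- cokernel `Z_k` is orthogonal to projectives.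
    obtain ⟨g, rfl⟩ := (hE (k + 1)).exact.desc' f (zero_of_epi_comp _ hf)
    obtain ⟨h, hh⟩ := hc.orthogonal _ (hZ k) _ _ _ (hE k) hQ g
    exact ⟨h, by rw [hd, Category.assoc, hh]⟩
  · have h := exact_epi_comp (p (0 + 1)) _ _ _ (hE 0).exact
    simp only [← hd] at h
    exact h

/-- A projective resolution `W` of `M` together with a comparison `α` from a complete projective
complex `T`, shifted `d` times, that is an isomorphism from degree `d` on. -/
structure TateDatum (M : C) where
  T : ChainComplex C ℤ
  complete : IsCompleteProjective T
  W : ℕ → C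
  δ : ∀ n, W (n + 1) ⟶ W n
  ε : W 0 ⟶ M
  projective : ∀ n, Projective (W n)
  δ_comp_δ : ∀ n, δ (n + 1) ≫ δ n = 0
  exact : ∀ n, (ShortComplex.mk _ _ (δ_comp_δ n)).Exact
  δ_comp_ε : δ 0 ≫ ε = 0
  exact_zero : (ShortComplex.mk _ _ δ_comp_ε).Exact
  epi : Epi ε
  d : ℕ
  α : ∀ (n : ℕ) (i : ℤ), i + d = n → (T.X i ⟶ W n)
  comm : ∀ (n : ℕ) (i j : ℤ) (hi : i + d = (n + 1 : ℕ)) (hj : j + d = n),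
    α (n + 1) i hi ≫ δ n = T.d i j ≫ α n j hj
  isIso : ∀ (n : ℕ) (i : ℤ) (h : i + d = n), d ≤ n → IsIso (α n i h)

lemma nonempty_tateDatum_of_gproj {G : C} (hG : gproj C G) : Nonempty (TateDatum G) := by
  obtain ⟨T, p, w, hT, hp, hE⟩ := exists_isCompleteProjective hG
  exact ⟨{
    T := T
    complete := hT
    W := fun n => T.X n
    δ := fun n => T.d (n + 1 : ℕ) n
    ε := p
    projective := fun n => hT.projective n
    δ_comp_δ := fun n => T.d_comp_d _ _ _
    exact := fun n => (exactAt_iff_of_eq T (by push_cast; ring) (by push_cast; ring)).1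
      (hT.acyclic (n + 1 : ℕ))
    δ_comp_ε := w
    exact_zero := hE
    epi := hp
    d := 0
    α := fun n i h => (T.XIsoOfEq (by simpa using h)).hom
    comm := fun n i j hi hj => by
      obtain rfl : i = (n + 1 : ℕ) := by simpa using hi
      obtain rfl : j = n := by simpa using hj
      simp
    isIso := fun n i h _ => inferInstance }⟩

/-- Tate data of a syzygy of `M` give Tate data of `M`. -/
lemma TateDatum.nonempty_of_isSyzygy {K M : C} (D : TateDatum K) (h : IsSyzygy K M) :
    Nonempty (TateDatum M) := by
  obtain ⟨P, i, p, w, hP, hE⟩ := h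
  have := hE.mono_f
  have := D.epi
  have hi : (0 : ℤ) - D.d - 1 + (D.d + 1 : ℕ) = 0 := by push_cast; ring
  -- `P` becomes the new degree `0` of the resolution. The composite `T_{-d} ⟶ W_0 ⟶ K ⟶ P` kills
  -- the image of `T_{1-d}`, so exactness of `Hom(T, P)` extends it to `T_{-d-1}`; this is the new
  -- lowest component of the comparison.
  obtain ⟨g, hg⟩ : ∃ g : D.T.X (0 - D.d - 1) ⟶ P, D.T.d (0 - D.d) (0 - D.d - 1) ≫ g =
      D.α 0 (0 - D.d) (by simp) ≫ D.ε ≫ i := by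
    refine D.complete.exists_extension (1 - D.d) _ _ (by ring) (by ring) P hP _ ?_
    rw [← reassoc_of% D.comm 0 (1 - D.d) (0 - D.d) (by simp) (by simp), reassoc_of% D.δ_comp_ε]
    simp
  let W' : ℕ → C := fun n => match n with
    | 0 => P
    | n + 1 => D.W n
  let δ' : ∀ n, W' (n + 1) ⟶ W' n := fun n => match n with
    | 0 => D.ε ≫ i
    | n + 1 => D.δ n
  let α' : ∀ (n : ℕ) (i : ℤ), i + (D.d + 1 : ℕ) = n → (D.T.X i ⟶ W' n) := fun n i h =>
    match n, h with
    | 0, h => (D.T.XIsoOfEq (by push_cast at h; linarith)).hom ≫ g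
    | n + 1, h => D.α n i (by push_cast at h; linarith)
  have hδ : ∀ n, δ' (n + 1) ≫ δ' n = 0
    | 0 => by change D.δ 0 ≫ D.ε ≫ i = 0; rw [reassoc_of% D.δ_comp_ε, zero_comp]
    | n + 1 => D.δ_comp_δ n
  exact ⟨{
    T := D.T
    complete := D.complete
    W := W'
    δ := δ'
    ε := p
    projective := fun
      | 0 => hP
      | n + 1 => D.projective n
    δ_comp_δ := hδ
    exact := fun
      | 0 => exact_comp_mono _ _ _ _ D.exact_zero
      | n + 1 => D.exact n
    δ_comp_ε := by change (D.ε ≫ i) ≫ p = 0; rw [Category.assoc, w, comp_zero]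
    exact_zero := exact_epi_comp _ _ _ _ hE.exact
    epi := hE.epi_g
    d := D.d + 1
    α := α'
    comm := fun n a b ha hb => by
      cases n with
      | zero =>
        obtain rfl : a = 0 - D.d := by push_cast at ha; linarith
        obtain rfl : b = 0 - D.d - 1 := by push_cast at hb; linarith
        change D.α 0 _ _ ≫ D.ε ≫ i = D.T.d _ _ ≫ (D.T.XIsoOfEq _).hom ≫ g
        rw [← hg]
        simp
      | succ n => exact D.comm n a b _ _
    isIso := fun n a h hn => by
      cases n with
      | zero => omega
      | succ n => exact D.isIso n a _ (by omega) }⟩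

lemma HasGprojSyzygy.nonempty_tateDatum {M : C} (h : HasGprojSyzygy M) :
    Nonempty (TateDatum M) := by
  induction h with
  | of_gproj hG => exact nonempty_tateDatum_of_gproj hG
  | step h _ ih => exact ih.some.nonempty_of_isSyzygy h

/-- The objects of a sequence indexed by `ℕ`, extended by zero to `ℤ`. -/
def extendByZeroX (W : ℕ → C) : ℤ → C
  | .ofNat n => W n
  | .negSucc _ => 0

/-- The differentials of the extension by zero. -/
def extendByZeroD {W : ℕ → C} (δ : ∀ n, W (n + 1) ⟶ W n) :
    ∀ n, extendByZeroX W (n + 1) ⟶ extendByZeroX W n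
  | .ofNat n => δ n
  | .negSucc _ => 0

/-- A complex indexed by `ℕ`, extended by zero to `ℤ`. -/
def extendByZero {W : ℕ → C} (δ : ∀ n, W (n + 1) ⟶ W n) (h : ∀ n, δ (n + 1) ≫ δ n = 0) :
    ChainComplex C ℤ :=
  ChainComplex.of (extendByZeroX W) (extendByZeroD δ) fun
    | .ofNat n => h n
    | .negSucc _ => comp_zero

lemma extendByZero_d {W : ℕ → C} (δ : ∀ n, W (n + 1) ⟶ W n) (h : ∀ n, δ (n + 1) ≫ δ n = 0)
    (n : ℤ) : (extendByZero δ h).d (n + 1) n = extendByZeroD δ n :=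
  ChainComplex.of_d _ _ _

/-- The reindexed complex with `T.X (n - d)` in degree `n`. -/
@[simps]
def reindex (T : ChainComplex C ℤ) (d : ℤ) : ChainComplex C ℤ where
  X n := T.X (n - d)
  d i j := T.d (i - d) (j - d)
  shape i j h := T.shape _ _ fun (h' : j - d + 1 = i - d) => h (by change j + 1 = i; linarith)
  d_comp_d' _ _ _ _ _ := T.d_comp_d _ _ _

lemma IsCompleteProjective.reindex {T : ChainComplex C ℤ} (hT : IsCompleteProjective T) (d : ℤ) :
    IsCompleteProjective (reindex T d) where
  projective _ := hT.projective _
  acyclic n := (exactAt_iff_of_eq (RelTate.reindex T d) (i := n + 1) (k := n - 1) (by ring)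
    (by ring)).2 ((exactAt_iff_of_eq T (by ring) (by ring)).1 (hT.acyclic (n - d)))
  exists_extension i j k hi hk Q hQ f hf :=
    hT.exists_extension (i - d) (j - d) (k - d) (by linarith) (by linarith) Q hQ f hf

/-- Shifting `T` by `d` makes the comparison degree-preserving; in negative degrees `W` is zero, so
extending the comparison by zero gives a chain map. -/
lemma TateDatum.exists_complexes {M : C} (D : TateDatum M) :
    ∃ (T W : ChainComplex C ℤ) (α : T ⟶ W) (ε : W.X 0 ⟶ M) (w : W.d 1 0 ≫ ε = 0),
      IsCompleteProjective T ∧ (∀ n, Projective (W.X n)) ∧ (∀ n, n < 0 → IsZero (W.X n)) ∧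
      (∀ n, 0 < n → W.ExactAt n) ∧ (ShortComplex.mk _ _ w).Exact ∧ Epi ε ∧
      ∃ n₀ : ℤ, ∀ n, n₀ ≤ n → IsIso (α.f n) := by
  let W := extendByZero D.δ D.δ_comp_δ
  let f : ∀ n : ℤ, (reindex D.T D.d).X n ⟶ W.X n := fun
    | .ofNat n => D.α n (Int.ofNat n - D.d) (by simp)
    | .negSucc _ => 0
  have hf : ∀ n : ℤ, f (n + 1) ≫ W.d (n + 1) n = (reindex D.T D.d).d (n + 1) n ≫ f n := by
    rintro (n | n)
    · exact (congrArg _ (extendByZero_d _ _ _)).trans (D.comm n _ _ _ _)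
    · exact (isZero_zero C).eq_of_tgt _ _
  have hd : W.d 1 0 = D.δ 0 := extendByZero_d D.δ D.δ_comp_δ 0
  refine ⟨_, W, ⟨f, ?_⟩, D.ε, (congrArg (· ≫ D.ε) hd).trans D.δ_comp_ε,
    D.complete.reindex D.d, ?_, ?_, ?_, ?_, D.epi, D.d, ?_⟩
  · rintro _ j rfl
    exact hf j
  · rintro (n | n)
    · exact D.projective n
    · exact (isZero_zero C).projective
  · rintro (n | n) hn
    · exact absurd hn (by simp)
    · exact isZero_zero C
  · intro n hn
    obtain ⟨m, rfl⟩ : ∃ m : ℕ, n = Int.ofNat m + 1 := ⟨(n - 1).toNat, by simp; omega⟩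
    rw [exactAt_iff_of_eq W rfl rfl]
    simp only [W, extendByZero_d]
    exact D.exact m
  · have hE := D.exact_zero
    simp only [← hd] at hE
    exact hE
  · rintro (n | n) hn
    · exact D.isIso n _ _ (by simpa using hn)
    · exact absurd hn (by have := Int.negSucc_lt_zero n; omega)

end Abelian

/-! ### Tate resolutions from Tate data, dualization, and finite relative dimension. -/

section Abelian

variable {C : Type u} [Category.{v} C] [Abelian C]

instance preservesHomology_preadditiveCoyoneda_obj (P : C) [Projective P] :
    (preadditiveCoyoneda.obj (op P)).PreservesHomology := by
  have := (Projective.projective_iff_preservesEpimorphisms_preadditiveCoyoneda_obj P).1 ‹_›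
  apply Functor.preservesHomology_of_preservesEpis_and_kernels

instance preservesHomology_preadditiveYoneda_obj (J : C) [Injective J] :
    (preadditiveYoneda.obj J).PreservesHomology := by
  have := (Injective.injective_iff_preservesEpimorphisms_preadditiveYoneda_obj J).1 ‹_›
  apply Functor.preservesHomology_of_preservesEpis_and_kernels

lemma homFrom_exactAt_iff (A : C) (X : ChainComplex C ℤ) {i j k : ℤ} (hi : j + 1 = i)
    (hk : k + 1 = j) : (homFrom A X).ExactAt j ↔
      ∀ f : A ⟶ X.X j, f ≫ X.d j k = 0 → ∃ g : A ⟶ X.X i, g ≫ X.d i j = f := by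
  rw [HomologicalComplex.exactAt_iff' _ i j k (ComplexShape.prev_eq' _ hi)
    (ComplexShape.next_eq' _ hk), ShortComplex.ab_exact_iff]
  rfl

lemma homTo_exactAt_iff (A : C) (X : ChainComplex C ℤ) {i j k : ℤ} (hi : j + 1 = i)
    (hk : k + 1 = j) : (homTo X A).ExactAt j ↔
      ∀ f : X.X j ⟶ A, X.d i j ≫ f = 0 → ∃ g : X.X k ⟶ A, X.d j k ≫ g = f := by
  rw [HomologicalComplex.exactAt_iff' _ k j i (ComplexShape.prev_eq' _ hk)
    (ComplexShape.next_eq' _ hi), ShortComplex.ab_exact_iff]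
  rfl

lemma isHomToExact_iff (𝒲 : ObjectProperty C) (X : ChainComplex C ℤ) :
    IsHomToExact 𝒲 X ↔ ∀ i j k : ℤ, j + 1 = i → k + 1 = j → ∀ Q : C, 𝒲 Q →
      ∀ f : X.X j ⟶ Q, X.d i j ≫ f = 0 → ∃ g : X.X k ⟶ Q, X.d j k ≫ g = f :=
  ⟨fun h _ j _ hi hk Q hQ => (homTo_exactAt_iff Q X hi hk).1 (h Q hQ j),
    fun h Q hQ j => (homTo_exactAt_iff Q X rfl (sub_add_cancel j 1)).2
      (h _ _ _ rfl (sub_add_cancel j 1) Q hQ)⟩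

lemma isHomFromExact_iff (𝒲 : ObjectProperty C) (X : ChainComplex C ℤ) :
    IsHomFromExact 𝒲 X ↔ ∀ i j k : ℤ, j + 1 = i → k + 1 = j → ∀ Q : C, 𝒲 Q →
      ∀ f : Q ⟶ X.X j, f ≫ X.d j k = 0 → ∃ g : Q ⟶ X.X i, g ≫ X.d i j = f :=
  ⟨fun h _ j _ hi hk Q hQ => (homFrom_exactAt_iff Q X hi hk).1 (h Q hQ j),
    fun h Q hQ j => (homFrom_exactAt_iff Q X rfl (sub_add_cancel j 1)).2
      (h _ _ _ rfl (sub_add_cancel j 1) Q hQ)⟩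

lemma isHomFromExact_isProjective {X : ChainComplex C ℤ} (hX : X.Acyclic) :
    IsHomFromExact (isProjective C) X := by
  rw [isHomFromExact_iff]
  rintro i j k hi hk Q (hQ : Projective Q) f hf
  have h := (exactAt_iff_of_eq X hi hk).1 (hX j)
  exact ⟨h.liftFromProjective f hf, h.liftFromProjective_comp f hf⟩

lemma isHomToExact_isInjective {X : ChainComplex C ℤ} (hX : X.Acyclic) :
    IsHomToExact (isInjective C) X := by
  rw [isHomToExact_iff]
  rintro i j k hi hk Q (hQ : Injective Q) f hf
  have h := (exactAt_iff_of_eq X hi hk).1 (hX j)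
  exact ⟨h.descToInjective f hf, h.comp_descToInjective f hf⟩

/-- `Hom(A, -)` is exact for projective `A`, hence preserves quasi-isomorphisms. -/
lemma Resolution.isProper_of_projective {M : C} (ρ : Resolution (isProjective C) M) :
    ρ.IsProper := by
  rintro A (hA : Projective A)
  have := ρ.quasiIso
  infer_instance

lemma Coresolution.isProper_of_injective {N : C} (ρ : Coresolution (isInjective C) N) :
    ρ.IsProper := by
  rintro A (hA : Injective A)
  have := ρ.quasiIso
  have : QuasiIso ((HomologicalComplex.opFunctor C (ComplexShape.down ℤ)).map ρ.δ.op) :=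
    (HomologicalComplex.quasiIso_opFunctor_map_iff _).2 this
  infer_instance

/-- The chain map to `M` given by an augmentation. -/
def augmentation {X : ChainComplex C ℤ} {M : C} (ε : X.X 0 ⟶ M) (w : X.d 1 0 ≫ ε = 0) :
    X ⟶ inDegreeZero M :=
  HomologicalComplex.mkHomToSingle ε fun i (hi : 0 + 1 = i) => by subst hi; exact w

/-- The chain map from `N` given by a coaugmentation. -/
def coaugmentation {Y : ChainComplex C ℤ} {N : C} (ι : N ⟶ Y.X 0) (w : ι ≫ Y.d 0 (-1) = 0) :
    inDegreeZero N ⟶ Y :=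
  HomologicalComplex.mkHomFromSingle ι fun k (hk : k + 1 = 0) => by
    obtain rfl : k = -1 := by omega
    exact w

lemma quasiIso_augmentation {X : ChainComplex C ℤ} {M : C} (ε : X.X 0 ⟶ M) (w : X.d 1 0 ≫ ε = 0)
    (hX : ∀ n, n < 0 → IsZero (X.X n)) (hX' : ∀ n, 0 < n → X.ExactAt n)
    (h : (ShortComplex.mk _ _ w).Exact) (hε : Epi ε) : QuasiIso (augmentation ε w) := by
  refine ⟨fun n => ?_⟩
  by_cases hn : n = 0
  · subst hn
    rw [quasiIsoAt_iff' _ 1 0 (-1) (by simp) (by simp), ShortComplex.quasiIso_iff_of_zeros' _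
      ((hX _ (by simp)).eq_of_tgt _ _) rfl rfl]
    have hf : (augmentation ε w).f 0 = ε ≫ (HomologicalComplex.singleObjXSelf _ _ _).inv :=
      HomologicalComplex.mkHomToSingle_f _ _
    have hepi : Epi ((augmentation ε w).f 0) := by
      rw [hf]
      infer_instance
    refine ⟨?_, hepi⟩
    let φ : ShortComplex.mk _ _ w ⟶ ShortComplex.mk (X.d 1 0) ((augmentation ε w).f 0)
        (by rw [hf, reassoc_of% w, zero_comp]) :=
      { τ₁ := 𝟙 _, τ₂ := 𝟙 _, τ₃ := (HomologicalComplex.singleObjXSelf (ComplexShape.down ℤ) 0 M).inv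
        comm₂₃ := by simp [hf] }
    exact (ShortComplex.exact_iff_of_epi_of_isIso_of_mono φ).1 h
  · rw [quasiIsoAt_iff_exactAt' _ _ (HomologicalComplex.exactAt_single_obj _ _ _ _ hn)]
    rcases lt_or_gt_of_ne hn with hn | hn
    · exact .of_isZero (hX n hn)
    · exact hX' n hn

lemma quasiIso_coaugmentation {Y : ChainComplex C ℤ} {N : C} (ι : N ⟶ Y.X 0)
    (w : ι ≫ Y.d 0 (-1) = 0) (hY : ∀ n, 0 < n → IsZero (Y.X n)) (hY' : ∀ n, n < 0 → Y.ExactAt n)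
    (h : (ShortComplex.mk _ _ w).Exact) (hι : Mono ι) : QuasiIso (coaugmentation ι w) := by
  refine ⟨fun n => ?_⟩
  by_cases hn : n = 0
  · subst hn
    rw [quasiIsoAt_iff' _ 1 0 (-1) (by simp) (by simp), ShortComplex.quasiIso_iff_of_zeros _
      rfl rfl ((hY _ (by simp)).eq_of_src _ _)]
    have hf : (coaugmentation ι w).f 0 = (HomologicalComplex.singleObjXSelf _ _ _).hom ≫ ι :=
      HomologicalComplex.mkHomFromSingle_f _ _
    have hmono : Mono ((coaugmentation ι w).f 0) := by
      rw [hf]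
      infer_instance
    refine ⟨?_, hmono⟩
    let φ : ShortComplex.mk ((coaugmentation ι w).f 0) (Y.d 0 (-1))
        (by rw [hf, Category.assoc, w, comp_zero]) ⟶ ShortComplex.mk _ _ w :=
      { τ₁ := (HomologicalComplex.singleObjXSelf (ComplexShape.down ℤ) 0 N).hom, τ₂ := 𝟙 _, τ₃ := 𝟙 _
        comm₁₂ := by simp [hf] }
    exact (ShortComplex.exact_iff_of_epi_of_isIso_of_mono φ).2 h
  · rw [quasiIsoAt_iff_exactAt _ _ (HomologicalComplex.exactAt_single_obj _ _ _ _ hn)]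
    rcases lt_or_gt_of_ne hn with hn | hn
    · exact hY' n hn
    · exact .of_isZero (hY n hn)

lemma TateDatum.nonempty_tateResolution {M : C} (D : TateDatum M) :
    Nonempty (TateResolution (isProjective C) M) := by
  obtain ⟨T, W, α, ε, w, hT, hW, hW₀, hW₁, hE, hε, hα⟩ := D.exists_complexes
  let ρ : Resolution (isProjective C) M :=
    { X := W
      γ := augmentation ε w
      mem := fun n _ => hW n
      isZero := hW₀
      quasiIso := quasiIso_augmentation ε w hW₀ hW₁ hE hε }
  exact ⟨{
    T := T
    W := ρ
    α := α
    totallyAcyclic := ⟨hT.projective, hT.acyclic, isHomFromExact_isProjective hT.acyclic,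
      (isHomToExact_iff _ _).2 hT.exists_extension⟩
    isProper := ρ.isProper_of_projective
    isIso := hα }⟩

/-- The complex of `C` obtained from a complex of `Cᵒᵖ` by reversing the arrows, with the object
of degree `-n` placed in degree `n`. -/
@[simps]
def unopNeg (X : ChainComplex Cᵒᵖ ℤ) : ChainComplex C ℤ where
  X n := unop (X.X (-n))
  d i j := (X.d (-j) (-i)).unop
  shape i j h := by
    rw [X.shape _ _ fun (h' : -i + 1 = -j) => h (by change j + 1 = i; omega)]
    rfl
  d_comp_d' _ _ _ _ _ := by rw [← unop_comp, X.d_comp_d]; rfl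

lemma exactAt_unopNeg {X : ChainComplex Cᵒᵖ ℤ} {n : ℤ} (h : X.ExactAt (-n)) :
    (unopNeg X).ExactAt n := by
  rw [exactAt_iff_of_eq _ rfl (sub_add_cancel n 1)]
  exact ((exactAt_iff_of_eq X (i := -(n - 1)) (j := -n) (k := -(n + 1)) (by ring) (by ring)).1
    h).unop

/-- Tate data in the opposite category give Tate coresolutions by injective objects. -/
lemma TateDatum.nonempty_tateCoresolution {N : C} (D : TateDatum (op N)) :
    Nonempty (TateCoresolution (isInjective C) N) := by
  obtain ⟨T, W, α, ε, w, hT, hW, hW₀, hW₁, hE, hε, n₀, hα⟩ := D.exists_complexes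
  have hV₀ : ∀ n, 0 < n → IsZero ((unopNeg W).X n) := fun n hn => (hW₀ (-n) (by omega)).unop
  let ι : N ⟶ (unopNeg W).X 0 := ε.unop
  have w' : ι ≫ (unopNeg W).d 0 (-1) = 0 := congrArg Quiver.Hom.unop w
  have hS : ∀ n, Injective ((unopNeg T).X n) := fun n => by
    have := hT.projective (-n)
    exact inferInstanceAs (Injective (unop (T.X (-n))))
  have hS' : (unopNeg T).Acyclic := fun n => exactAt_unopNeg (hT.acyclic _)
  let ρ : Coresolution (isInjective C) N :=
    { Y := unopNeg W
      δ := coaugmentation ι w'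
      mem := fun n _ => by
        have := hW (-n)
        exact inferInstanceAs (Injective (unop (W.X (-n))))
      isZero := hV₀
      quasiIso := quasiIso_coaugmentation ι w' hV₀
        (fun n hn => exactAt_unopNeg (hW₁ _ (by omega))) hE.unop
        (inferInstanceAs (Mono ε.unop)) }
  exact ⟨{
    S := unopNeg T
    V := ρ
    β := { f := fun n => (α.f (-n)).unop
           comm' := fun i j _ => congrArg Quiver.Hom.unop (α.comm (-j) (-i)).symm }
    totallyAcyclic := ⟨hS, hS', (isHomFromExact_iff _ _).2 fun i j k hi hk Q hQ f hf => by
        have hQ' : Injective Q := hQ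
        obtain ⟨g, hg⟩ := hT.exists_extension (-k) (-j) (-i) (by omega) (by omega) (op Q)
          inferInstance f.op (congrArg Quiver.Hom.op hf)
        exact ⟨g.unop, congrArg Quiver.Hom.unop hg⟩, isHomToExact_isInjective hS'⟩
    isProper := ρ.isProper_of_injective
    isIso := ⟨-n₀, fun n hn => by
      have := hα (-n) (by omega)
      exact inferInstanceAs (IsIso (α.f (-n)).unop)⟩ }⟩

lemma HasFiniteGprojResolution.of_iso {M M' : C} (h : HasFiniteGprojResolution M) (e : M ≅ M') :
    HasFiniteGprojResolution M' := by
  cases h with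
  | of_gproj hG => exact .of_gproj (gproj_of_iso e hG)
  | step i p w h hK hG => exact .step _ _ _ (ShortExact.of_isos h (Iso.refl _) e) hK hG

lemma hasFiniteGprojResolution_of_isZero {Z : C} (hZ : IsZero Z) : HasFiniteGprojResolution Z :=
  .of_gproj (gproj_of_projective Z hZ.projective)

/-- Descending induction along `C_{j+1} ⟶ X_j ⟶ C_j`, starting from `C_b = 0`. -/
lemma hasFiniteGprojResolution_opcycles (X : ChainComplex C ℤ) (hX : ∀ n, 0 ≤ n → gproj C (X.X n))
    (hX' : ∀ n, 0 < n → X.ExactAt n) (b : ℕ) (hb : ∀ n : ℕ, b ≤ n → IsZero (X.X n)) :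
    HasFiniteGprojResolution (X.opcycles 0) := by
  suffices ∀ k : ℕ, k ≤ b → HasFiniteGprojResolution (X.opcycles (b - k)) by
    simpa using this b le_rfl
  intro k
  induction k with
  | zero =>
    intro _
    refine hasFiniteGprojResolution_of_isZero (.of_epi (X.pOpcycles _) ?_)
    simpa using hb b le_rfl
  | succ k ih =>
    intro hk
    exact .step _ _ _ (shortExact_opcycles X (i := b - k) (by push_cast; ring)
      (hX' _ (by omega))) (ih (by omega)) (hX _ (by omega))

lemma hasFiniteGprojResolution_op_cycles (Y : ChainComplex C ℤ)
    (hY : ∀ n, n ≤ 0 → gproj Cᵒᵖ (op (Y.X n))) (hY' : ∀ n, n < 0 → Y.ExactAt n) (b : ℕ)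
    (hb : ∀ n : ℕ, b ≤ n → IsZero (Y.X (-n))) :
    HasFiniteGprojResolution (op (Y.cycles 0)) := by
  suffices ∀ k : ℕ, k ≤ b → HasFiniteGprojResolution (op (Y.cycles (k - b))) by
    simpa using this b le_rfl
  intro k
  induction k with
  | zero =>
    intro _
    refine hasFiniteGprojResolution_of_isZero (IsZero.op (.of_mono (Y.iCycles _) ?_))
    simpa using hb b le_rfl
  | succ k ih =>
    intro hk
    exact .step _ _ _ (shortExact_cycles Y (i := (k + 1 : ℕ) - b) (j := k - b)
      (by push_cast; ring) (hY' _ (by omega))).op (ih (by omega)) (hY _ (by omega))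

lemma Resolution.isZero_of_length_lt {M : C} {𝒳 : ObjectProperty C} (ρ : Resolution 𝒳 M) {n : ℕ}
    (hn : ρ.length < n) : IsZero (ρ.X.X n) := by
  by_contra h
  exact absurd (le_iSup₂_of_le (f := fun (n : ℕ) (_ : ¬ IsZero (ρ.X.X (n : ℤ))) => (n : ℕ∞))
    n h le_rfl) (not_le_of_gt hn)

lemma Coresolution.isZero_of_length_lt {N : C} {𝒴 : ObjectProperty C} (ρ : Coresolution 𝒴 N)
    {n : ℕ} (hn : ρ.length < n) : IsZero (ρ.Y.X (-n)) := by
  by_contra h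
  exact absurd (le_iSup₂_of_le (f := fun (n : ℕ) (_ : ¬ IsZero (ρ.Y.X (-(n : ℤ)))) => (n : ℕ∞))
    n h le_rfl) (not_le_of_gt hn)

lemma hasFiniteGprojResolution_of_relProjDim_lt_top {𝒳 : ObjectProperty C}
    (h𝒳 : ∀ X, 𝒳 X → gproj C X) {M : C} (hM : relProjDim 𝒳 M < ⊤) :
    HasFiniteGprojResolution M := by
  obtain ⟨ρ, hρ⟩ := iInf_lt_iff.1 hM
  obtain ⟨b, hb⟩ := ENat.ne_top_iff_exists.1 hρ.ne
  -- The length `b` is the last degree that may be nonzero, so vanishing starts at `b + 1`.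
  refine (hasFiniteGprojResolution_opcycles ρ.X (fun n hn => h𝒳 _ (ρ.mem n hn))
    (fun n hn => ρ.exactAt hn) (b + 1) fun n hn => ρ.isZero_of_length_lt ?_).of_iso ρ.opcyclesIso
  rw [← hb]
  exact_mod_cast hn

lemma hasFiniteGprojResolution_of_relInjDim_lt_top {𝒴 : ObjectProperty C}
    (h𝒴 : ∀ Y, 𝒴 Y → gproj Cᵒᵖ (op Y)) {N : C} (hN : relInjDim 𝒴 N < ⊤) :
    HasFiniteGprojResolution (op N) := by
  obtain ⟨ρ, hρ⟩ := iInf_lt_iff.1 hN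
  obtain ⟨b, hb⟩ := ENat.ne_top_iff_exists.1 hρ.ne
  refine (hasFiniteGprojResolution_op_cycles ρ.Y (fun n hn => h𝒴 _ (ρ.mem n hn))
    (fun n hn => ρ.exactAt hn) (b + 1) fun n hn => ρ.isZero_of_length_lt ?_).of_iso
    ρ.cyclesIso.symm.op
  rw [← hb]
  exact_mod_cast hn

/-- The syzygies of `X` in all degrees form one Gorenstein projective class: neighbours are syzygies
and cosyzygies of each other, and `Hom(-, Q)`-exactness gives orthogonality through the presentation
by `X_n`. -/
lemma gproj_opcycles {X : ChainComplex C ℤ} (hX : ∀ n, Projective (X.X n)) (hX' : X.Acyclic)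
    (h : IsHomToExact (isProjective C) X) (n : ℤ) : gproj C (X.opcycles n) := by
  refine ⟨fun A => ∃ n, A = X.opcycles n, ⟨?_, ?_, ?_⟩, n, rfl⟩
  · rintro _ ⟨n, rfl⟩
    exact ⟨_, ⟨n + 1, rfl⟩, _, _, _, _, hX n, shortExact_opcycles X rfl (hX' _)⟩
  · rintro _ ⟨n, rfl⟩
    exact ⟨_, ⟨n - 1, rfl⟩, _, _, _, _, hX _, shortExact_opcycles X (sub_add_cancel n 1) (hX' _)⟩
  · rintro _ ⟨n, rfl⟩
    refine isLeftOrthogonal_of_presentation (shortExact_opcycles X rfl (hX' (n + 1))) (hX n)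
      fun Q hQ f => ?_
    obtain ⟨g, hg⟩ := (isHomToExact_iff _ _).1 h _ _ _ rfl rfl Q hQ (X.pOpcycles (n + 1) ≫ f)
      (by simp)
    exact ⟨g, by rw [← cancel_epi (X.pOpcycles (n + 1)), ← hg]; simp⟩

/-- The same argument in the opposite category, where injectives are projective and the cosyzygies
of `Y` become syzygies. -/
lemma gproj_op_cycles {Y : ChainComplex C ℤ} (hY : ∀ n, Injective (Y.X n)) (hY' : Y.Acyclic)
    (h : IsHomFromExact (isInjective C) Y) (n : ℤ) : gproj Cᵒᵖ (op (Y.cycles n)) := by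
  refine ⟨fun A => ∃ n, A = op (Y.cycles n), ⟨?_, ?_, ?_⟩, n, rfl⟩
  · rintro _ ⟨n, rfl⟩
    have := hY n
    exact ⟨_, ⟨n - 1, rfl⟩, _, _, _, _, inferInstanceAs (Projective (op (Y.X n))),
      (shortExact_cycles Y (sub_add_cancel n 1) (hY' _)).op⟩
  · rintro _ ⟨n, rfl⟩
    have := hY (n + 1)
    exact ⟨_, ⟨n + 1, rfl⟩, _, _, _, _, inferInstanceAs (Projective (op (Y.X (n + 1)))),
      (shortExact_cycles Y rfl (hY' _)).op⟩
  · rintro _ ⟨n, rfl⟩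
    have := hY n
    refine isLeftOrthogonal_of_presentation
      (shortExact_cycles Y (sub_add_cancel n 1) (hY' (n - 1))).op
      (inferInstanceAs (Projective (op (Y.X n)))) fun Q hQ f => ?_
    let f' : unop Q ⟶ Y.cycles (n - 1) := f.unop
    obtain ⟨g, hg⟩ := (isHomFromExact_iff _ _).1 h n (n - 1) (n - 1 - 1) (by ring) (by ring)
      (unop Q) (inferInstanceAs (Injective (unop Q))) (f' ≫ Y.iCycles (n - 1)) (by simp)
    have hg' : g ≫ Y.toCycles n (n - 1) = f' := by
      rw [← cancel_mono (Y.iCycles (n - 1)), ← hg]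
      simp
    exact ⟨g.op, congrArg Quiver.Hom.op hg'⟩

end Abelian

/-! ### Gorenstein projective and injective modules. -/

section Modules

variable {R : Type u} [CommRing R]

lemma gproj_of_gorensteinProjective {M : ModuleCat.{u} R} (hM : gorensteinProjective R M) :
    gproj (ModuleCat.{u} R) M := by
  obtain ⟨X, hX, hX', h, ⟨e⟩⟩ := hM
  exact gproj_of_iso ((X.opcyclesIsCokernel 1 0 (by simp)).coconePointUniqueUpToIso
    (cokernelIsCokernel (X.d 1 0)) ≪≫ e.symm) (gproj_opcycles hX hX' h 0)

lemma gproj_op_of_gorensteinInjective {N : ModuleCat.{u} R} (hN : gorensteinInjective R N) :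
    gproj (ModuleCat.{u} R)ᵒᵖ (op N) := by
  obtain ⟨Y, hY, hY', h, ⟨e⟩⟩ := hN
  exact gproj_of_iso (e ≪≫ (kernelIsKernel (Y.d 0 (-1))).conePointUniqueUpToIso
    (Y.cyclesIsKernel 0 (-1) (by simp))).op (gproj_op_cycles hY hY' h 0)

end Modules

end RelTate

end

open RelTate in
/-- Tate projective resolutions of `M` and Tate injective coresolutions of `N` exist, and whichever
are used to compute them, the two Tate cohomology modules are isomorphic over `R`. -/
theorem corollary6p3 (R : Type u) [CommRing R] (M N : ModuleCat.{u} R)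
    (hM : gorensteinProjDim M < ⊤) (hN : gorensteinInjDim N < ⊤) :
    Nonempty (TateProjectiveResolution M) ∧ Nonempty (TateInjectiveCoresolution N) ∧
    ∀ (τ : TateProjectiveResolution M) (σ : TateInjectiveCoresolution N),
      (∀ n : ℤ, 1 ≤ n → Nonempty (τ.tateExt N n ≅ σ.tateExt M n)) ∧
      (IsGorensteinRing R → ∀ n : ℤ, Nonempty (τ.tateExt N n ≅ σ.tateExt M n)) := by
  have hM' := hasFiniteGprojResolution_of_relProjDim_lt_top
    (fun _ => gproj_of_gorensteinProjective) hM
  have hN' := hasFiniteGprojResolution_of_relInjDim_lt_top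
    (fun _ => gproj_op_of_gorensteinInjective) hN
  exact ⟨hM'.hasGprojSyzygy.nonempty_tateDatum.some.nonempty_tateResolution,
    hN'.hasGprojSyzygy.nonempty_tateDatum.some.nonempty_tateCoresolution,
    fun τ σ => ⟨fun n _ => tateExt_iso τ σ n, fun _ n => tateExt_iso τ σ n⟩⟩
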